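/- For $0<\alpha<1$ let $S(\alpha,1,1)$ denote the (maximally skewed, unit scale) $\alpha$-stable distribution on $\mathbb{R}$, i.e. the probability distribution, which exists, with characteristic function $$\mathrm{E}\,e^{iZ\lambda}=\exp\Big(-|\lambda|^{\alpha}\big(1-i\,\mathrm{sign}(\lambda)\tan\tfrac{\pi\alpha}{2}\big)\Big),\qquad \lambda\in\mathbb{R}.$$ Let $S_1,S_2$ be i.i.d. with distribution $S(\alpha,1,1)$ (they are almost surely positive) and, for $t\ge 0$, put $$F_\alpha(t)=\Pr\Big(\big(S_2/S_1\big)^{\alpha/(1-\alpha)}\le t\Big).$$ Then, for all $\alpha\in(0,1)$ and $t\ge 0$, $$F_\alpha(t)=\frac{1}{\pi^2}\int_0^{\pi}\!\!\int_0^{\pi}\frac{1}{1+Q_\alpha(u_1,u_2)/t}\,du_1\,du_2,$$ where $$Q_\alpha(u_1,u_2)=\left[\frac{\sin(\alpha u_2)}{\sin(\alpha u_1)}\right]^{\frac{\alpha}{1-\alpha}}\left[\frac{\sin u_1}{\sin u_2}\right]^{\frac{1}{1-\alpha}}\frac{\sin(u_2-\alpha u_2)}{\sin(u_1-\alpha u_1)},$$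 and the integrand is integrable; for $t=0$ it is read as its limit $0$, so that $F_\alpha(0)=0$. In particular, for every $t\ge 0$, $$\lim_{\alpha\to 0+}F_\alpha(t)=\frac{t}{1+t},\qquad F_{1/2}(t)=\frac{2}{\pi}\arctan\sqrt{t}.$$ Moreover, for any $t\in[0,1]$ and $0<\alpha_1\le\alpha_2\le \tfrac12$, $$\frac{t}{1+t}\le F_{\alpha_1}(t)\le F_{\alpha_2}(t)\le\frac{2}{\pi}\arctan\sqrt{t}.$$ -/

import Mathlib

open Real Set Filter Topology MeasureTheory ProbabilityTheory

noncomputable section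

/-- The characteristic function of the maximally-skewed `α`-stable distribution `S(α,1,1)` with
unit scale, `exp (-|x|^α (1 - i sign(x) tan(πα/2)))`, for `α ≠ 1`. -/
def maxSkewedStableCharFun (α x : ℝ) : ℂ :=
  Complex.exp (-((|x| ^ α : ℝ) : ℂ) *
    (1 - ((Real.sign x : ℝ) : ℂ) * Complex.I * ((Real.tan (π * α / 2) : ℝ) : ℂ)))

/-- `μ` is the distribution `S(α,1,1)`: the Borel probability measure on `ℝ` with the above
characteristic function. -/
structure IsMaxSkewedStable (α : ℝ) (μ : Measure ℝ) : Prop where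
  isProbabilityMeasure : IsProbabilityMeasure μ
  charFun_eq : ∀ x : ℝ, charFun μ x = maxSkewedStableCharFun α x

/-- `S₁, S₂` are i.i.d. random variables on the probability space `(Ω, P)` with distribution
`S(α,1,1)`. -/
structure IsIIDStablePair (α : ℝ) {Ω : Type*} [MeasurableSpace Ω] (P : Measure Ω)
    (S₁ S₂ : Ω → ℝ) : Prop where
  isProbabilityMeasure : IsProbabilityMeasure P
  aemeasurable₁ : AEMeasurable S₁ P
  aemeasurable₂ : AEMeasurable S₂ P
  indep : IndepFun S₁ S₂ P
  law₁ : IsMaxSkewedStable α (P.map S₁)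
  law₂ : IsMaxSkewedStable α (P.map S₂)

/-- `F_α(t) = Pr((S₂ / S₁)^(α/(1-α)) ≤ t)`. -/
def ratioCDF (α : ℝ) {Ω : Type*} [MeasurableSpace Ω] (P : Measure Ω) (S₁ S₂ : Ω → ℝ)
    (t : ℝ) : ℝ :=
  P.real {ω | (S₂ ω / S₁ ω) ^ (α / (1 - α)) ≤ t}

/-- The ratio `Q_α(u₁, u₂)` of sine expressions. -/
def stableQ (α u₁ u₂ : ℝ) : ℝ :=
  (sin (α * u₂) / sin (α * u₁)) ^ (α / (1 - α)) * (sin u₁ / sin u₂) ^ (1 / (1 - α)) *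
    (sin (u₂ - α * u₂) / sin (u₁ - α * u₁))

end

/-! Write A for `kanterFun α`. Kanter's representation says that, for U uniform on (0, π) and E
standard exponential, independent, X = (A(U)/E)^((1-α)/α) has Laplace transform exp(-s^α); a
rescaling of X then has law S(α,1,1). For two independent copies the outer exponents cancel:
(X₂/X₁)^(α/(1-α)) = Q_α(U₁,U₂) E₁/E₂. Since Pr(E₁ ≤ c E₂) = 1/(1+1/c), conditioning on the angles
gives the double integral (`ratioCDF_eq_integral`).

The representation comes from Laplace inversion of exp(-z^α)/z. Along the curve where xz - z^α is
real, the inversion integral is ∫ exp(-A(u) x^(-α/(1-α))) du, which is π Pr(X ≤ x) by conditioning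
on U. Moving the contour to the line Re z = s/2 does not change it
(`integral_exp_neg_kanterFun_eq_verticalIntegrand`). Integrating against s exp(-sx) dx under the
line integral leaves the Poisson integral of exp(-z^α) at the point s, hence exp(-s^α)
(`lintegral_exp_neg_kanterVar`). Analytic continuation to the right half-plane and a limit at the
imaginary axis give the characteristic function, which determines the law
(`IsMaxSkewedStable.eq_kanterLaw`).

For the inequalities, Euler's sine product writes log A(u) as a constant plus a sum of power series
in u² whose coefficients are nonnegative and increase with α. So for u₁ ≤ u₂ the ratio Q_α =
A(u₂)/A(u₁) is at least 1 and increases with α (`one_le_stableQ`, `stableQ_mono`). Swapping the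
angles inverts Q_α, and the integrand averaged over the swap is increasing in Q_α ≥ 1 when t ≤ 1
(`symmetrized_mono`). The value Q = 1 gives t/(1+t), both as lower bound and as limit for α → 0; at
α = 1/2 the integral is elementary and gives the arctangent. -/

/-! ### Kanter's function and the inversion kernel -/

/-- Kanter's function, `sin(αu)^{α/(1-α)} sin((1-α)u) / sin(u)^{1/(1-α)}`. -/
noncomputable def kanterFun (α u : ℝ) : ℝ :=
  sin (α * u) ^ (α / (1 - α)) * sin ((1 - α) * u) / sin u ^ (1 / (1 - α))

/-- The logarithm of the modulus, as a function of the argument `u`, along the curve on which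
`x z - z ^ α` is real. -/
noncomputable def kanterCurve (α x u : ℝ) : ℝ := log (sin (α * u) / (x * sin u)) / (1 - α)

/-- The inversion kernel `exp (x z - z ^ α)` in the logarithmic coordinate `z = exp w`. -/
noncomputable def stableKernel (α x : ℝ) (w : ℂ) : ℂ :=
  Complex.exp (x * Complex.exp w - Complex.exp (α * w))

section Basic

variable {α u x : ℝ}

lemma sin_mul_pos_of_mem_Ioo {c : ℝ} (hc : c ∈ Ioo (0 : ℝ) 1) (hu : u ∈ Ioo 0 π) :
    0 < sin (c * u) :=
  sin_pos_of_pos_of_lt_pi (mul_pos hc.1 hu.1) (by nlinarith [hc.1, hc.2, hu.1, hu.2])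

lemma one_sub_mem_Ioo (hα : α ∈ Ioo (0 : ℝ) 1) : 1 - α ∈ Ioo (0 : ℝ) 1 :=
  ⟨by linarith [hα.2], by linarith [hα.1]⟩

lemma kanterFun_pos (hα : α ∈ Ioo (0 : ℝ) 1) (hu : u ∈ Ioo 0 π) : 0 < kanterFun α u := by
  have h1 := sin_mul_pos_of_mem_Ioo hα hu
  have h2 := sin_mul_pos_of_mem_Ioo (one_sub_mem_Ioo hα) hu
  have h3 := sin_pos_of_mem_Ioo hu
  unfold kanterFun
  positivity

lemma measurable_kanterFun : Measurable (kanterFun α) := by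
  unfold kanterFun
  fun_prop

/-- This is the vanishing of the imaginary part of x z - z^α at z = exp(`kanterCurve α x u` + iu).
-/
lemma exp_kanterCurve (hα : α ∈ Ioo (0 : ℝ) 1) (hx : 0 < x) (hu : u ∈ Ioo 0 π) :
    x * exp (kanterCurve α x u) * sin u = exp (α * kanterCurve α x u) * sin (α * u) := by
  have h1 := sin_mul_pos_of_mem_Ioo hα hu
  have h3 := sin_pos_of_mem_Ioo hu
  have h0 := (one_sub_mem_Ioo hα).1
  have : exp (kanterCurve α x u) =
      exp (α * kanterCurve α x u) * (sin (α * u) / (x * sin u)) := by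
    rw [← exp_log (show 0 < sin (α * u) / (x * sin u) by positivity), ← exp_add]
    congr 1
    unfold kanterCurve
    field_simp
    ring
  rw [this]
  field_simp

/-- The left side is minus the real part of x z - z^α on the curve, by the subtraction formula for
the sine. -/
lemma exp_mul_kanterCurve (hα : α ∈ Ioo (0 : ℝ) 1) (hx : 0 < x) (hu : u ∈ Ioo 0 π) :
    exp (α * kanterCurve α x u) * sin ((1 - α) * u) / sin u =
      kanterFun α u * x ^ (-(α / (1 - α))) := by
  have h1 := sin_mul_pos_of_mem_Ioo hα hu
  have h3 := sin_pos_of_mem_Ioo hu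
  have h0 := (one_sub_mem_Ioo hα).1
  have e1 : exp (α * kanterCurve α x u) = (sin (α * u) / (x * sin u)) ^ (α / (1 - α)) := by
    rw [rpow_def_of_pos (by positivity), kanterCurve]
    congr 1
    field_simp
  have e2 : sin u ^ (1 / (1 - α)) = sin u ^ (α / (1 - α)) * sin u := by
    rw [← rpow_add_one h3.ne']
    congr 1
    field_simp
    ring
  rw [e1, kanterFun, e2, div_rpow h1.le (by positivity), mul_rpow hx.le h3.le, rpow_neg hx.le]
  have := rpow_pos_of_pos hx (α / (1 - α))
  have := rpow_pos_of_pos h3 (α / (1 - α))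
  field_simp

lemma stableKernel_exponent (α x R u : ℝ) :
    (x : ℂ) * Complex.exp (R + u * Complex.I) - Complex.exp (α * (R + u * Complex.I)) =
      (x * exp R * cos u - exp (α * R) * cos (α * u) : ℝ) +
        (x * exp R * sin u - exp (α * R) * sin (α * u) : ℝ) * Complex.I := by
  have hw : (α : ℂ) * (R + u * Complex.I) =
    ((α * R : ℝ) : ℂ) + ((α * u : ℝ) : ℂ) * Complex.I := by push_cast; ring
  rw [hw, Complex.exp_add_mul_I, Complex.exp_add_mul_I]
  push_cast
  ring

lemma norm_stableKernel (α x R u : ℝ) :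
    ‖stableKernel α x (R + u * Complex.I)‖ =
      exp (x * exp R * cos u - exp (α * R) * cos (α * u)) := by
  rw [stableKernel, stableKernel_exponent, Complex.norm_exp]
  simp only [Complex.add_re, Complex.ofReal_re, Complex.re_ofReal_mul, Complex.I_re, mul_zero,
    add_zero]

lemma stableKernel_kanterCurve (hα : α ∈ Ioo (0 : ℝ) 1) (hx : 0 < x) (hu : u ∈ Ioo 0 π) :
    stableKernel α x (kanterCurve α x u + u * Complex.I) =
      (exp (-(kanterFun α u * x ^ (-(α / (1 - α))))) : ℝ) := by
  have h3 := sin_pos_of_mem_Ioo hu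
  have e := exp_kanterCurve hα hx hu
  have h4 : (1 - α) * u = u - α * u := by ring
  rw [← exp_mul_kanterCurve hα hx hu, stableKernel, stableKernel_exponent, Complex.ofReal_exp,
    e, sub_self, Complex.ofReal_zero, zero_mul, add_zero, h4, sin_sub]
  congr 2
  field_simp
  linear_combination (cos u) * e

lemma stableKernel_ofReal (α x R : ℝ) :
    stableKernel α x R = (exp (x * exp R - exp (α * R)) : ℝ) := by
  rw [stableKernel]; push_cast; rfl

lemma differentiable_stableKernel (α x : ℝ) : Differentiable ℂ (stableKernel α x) := by
  unfold stableKernel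
  fun_prop

end Basic

/-! ### Decay of the kernel at infinity -/

lemma tendsto_exp_sub_mul_exp {α d : ℝ} (hα : α ∈ Ioo (0 : ℝ) 1) (hd : 0 < d) :
    Tendsto (fun R : ℝ => exp (exp (α * R) - d * exp R)) atTop (𝓝 0) := by
  apply tendsto_exp_atBot.comp
  have h0 := (one_sub_mem_Ioo hα).1
  have h1 : Tendsto (fun R : ℝ => exp (α * R)) atTop atTop :=
    tendsto_exp_atTop.comp (tendsto_id.const_mul_atTop hα.1)
  have h2 : Tendsto (fun R : ℝ => exp ((1 - α) * R)) atTop atTop :=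
    tendsto_exp_atTop.comp (tendsto_id.const_mul_atTop h0)
  have h3 : Tendsto (fun R : ℝ => 1 + (-d) * exp ((1 - α) * R)) atTop atBot :=
    tendsto_atBot_add_const_left _ _ (h2.const_mul_atTop_of_neg (by linarith))
  refine (h1.atTop_mul_atBot₀ h3).congr fun R => ?_
  have : exp R = exp (α * R) * exp ((1 - α) * R) := by rw [← exp_add]; ring_nf
  rw [this]; ring

lemma tendsto_exp_const_sub_mul_exp {α d C : ℝ} (hα : α ∈ Ioo (0 : ℝ) 1) (hd : 0 < d) :
    Tendsto (fun R : ℝ => exp (C - d * exp (α * R))) atTop (𝓝 0) := by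
  apply tendsto_exp_atBot.comp
  have h1 : Tendsto (fun R : ℝ => exp (α * R)) atTop atTop :=
    tendsto_exp_atTop.comp (tendsto_id.const_mul_atTop hα.1)
  refine (tendsto_atBot_add_const_left _ C (h1.const_mul_atTop_of_neg
    (show -d < 0 by linarith))).congr fun R => by ring

/-- The kernel is uniformly small far to the left of a vertical line in the `z`-plane. -/
lemma exists_bound_stableKernel {α x : ℝ} (hα : α ∈ Ioo (0 : ℝ) 1) (hx : 0 < x) (C : ℝ) :
    ∃ B : ℝ → ℝ, Tendsto B atTop (𝓝 0) ∧ ∀ R u : ℝ, 0 ≤ u → u ≤ π → exp R * cos u ≤ C →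
      ‖stableKernel α x (R + u * Complex.I)‖ ≤ B R := by
  have h1a : 0 < 1 + α := by linarith [hα.1]
  -- This angle satisfies v > π/2 and αv = π - v < π/2. Below v the term -z^α supplies the decay,
  -- since cos(αu) ≥ cos(αv) > 0; above v the term xz does, since cos u ≤ cos v < 0.
  set v := π / (1 + α) with hv
  have hv2 : π / 2 < v := by
    rw [hv, div_lt_div_iff₀ (by norm_num) h1a]; nlinarith [pi_pos, hα.2]
  have hvπ : v ≤ π := by rw [hv, div_le_iff₀ h1a]; nlinarith [pi_pos, hα.1]
  have hav : α * v < π / 2 := by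
    have : v * (1 + α) = π := by rw [hv]; field_simp
    linarith
  have hv0 : 0 < v := by linarith [pi_pos]
  have hc1 : 0 < cos (α * v) :=
    cos_pos_of_mem_Ioo ⟨by nlinarith [pi_pos, mul_pos hα.1 hv0], hav⟩
  have hc2 : 0 < -cos v := by
    have := cos_neg_of_pi_div_two_lt_of_lt hv2 (by linarith [pi_pos])
    linarith
  refine ⟨fun R => exp (x * C - cos (α * v) * exp (α * R)) +
    exp (exp (α * R) - (x * -cos v) * exp R), ?_, ?_⟩
  · simpa using (tendsto_exp_const_sub_mul_exp hα hc1).add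
      (tendsto_exp_sub_mul_exp hα (mul_pos hx hc2))
  · intro R u hu0 huπ hC
    rw [norm_stableKernel]
    have hE := exp_pos (α * R)
    have hE' := exp_pos R
    rcases le_total u v with h | h
    · have : cos (α * v) ≤ cos (α * u) :=
        cos_le_cos_of_nonneg_of_le_pi (mul_nonneg hα.1.le hu0) (by linarith [pi_pos])
          (mul_le_mul_of_nonneg_left h hα.1.le)
      have h2 : x * exp R * cos u - exp (α * R) * cos (α * u) ≤
          x * C - cos (α * v) * exp (α * R) := by
        nlinarith [mul_le_mul_of_nonneg_left hC hx.le, mul_le_mul_of_nonneg_left this hE.le]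
      linarith [exp_le_exp.2 h2, exp_pos (exp (α * R) - (x * -cos v) * exp R)]
    · have : cos u ≤ cos v := cos_le_cos_of_nonneg_of_le_pi hv0.le huπ h
      have h2 : x * exp R * cos u - exp (α * R) * cos (α * u) ≤
          exp (α * R) - (x * -cos v) * exp R := by
        nlinarith [mul_le_mul_of_nonneg_left this (mul_pos hx hE').le,
          mul_le_mul_of_nonneg_left (neg_one_le_cos (α * u)) hE.le]
      linarith [exp_le_exp.2 h2, exp_pos (x * C - cos (α * v) * exp (α * R))]

/-! ### The inversion integral along a vertical line -/

/-- The logarithm of the modulus, as a function of the argument `u`, along the vertical line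
`re z = s / 2`. -/
noncomputable def verticalCurve (s u : ℝ) : ℝ := log (s / (2 * cos u))

/-- The integrand of the inversion integral along the line `re z = s / 2`. -/
noncomputable def verticalIntegrand (α s x u : ℝ) : ℂ :=
  stableKernel α x (verticalCurve s u + u * Complex.I) * (tan u + Complex.I)

lemma exp_verticalCurve {s u : ℝ} (hs : 0 < s) (hu : 0 < cos u) :
    exp (verticalCurve s u) = s / (2 * cos u) := by
  rw [verticalCurve, exp_log (by positivity)]

/-- The constant comes from the tangent line of exp at log(1/(cα)), the value of αR at which the
left side is maximal. -/
lemma exists_linear_sub_exp_le {α c : ℝ} (hα : 0 < α) (hc : 0 < c) :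
    ∃ M : ℝ, ∀ R : ℝ, R - c * exp (α * R) ≤ M := by
  refine ⟨(log (1 / (c * α)) - 1) / α, fun R => ?_⟩
  have hK : 0 < 1 / (c * α) := by positivity
  have h := add_one_le_exp (α * R - log (1 / (c * α)))
  have e : exp (α * R) = 1 / (c * α) * exp (α * R - log (1 / (c * α))) := by
    rw [exp_sub, exp_log hK]; field_simp
  have h2 : c * exp (α * R) ≥ 1 / α * (α * R - log (1 / (c * α)) + 1) := by
    rw [e]
    have : c * (1 / (c * α) * exp (α * R - log (1 / (c * α)))) =
      1 / α * exp (α * R - log (1 / (c * α))) := by field_simp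
    rw [this]
    exact mul_le_mul_of_nonneg_left h (by positivity)
  have h3 : 1 / α * (α * R - log (1 / (c * α)) + 1) = R - (log (1 / (c * α)) - 1) / α := by
    field_simp; ring
  linarith

lemma cos_half_pi_mul_pos {α : ℝ} (hα : α ∈ Ioo (0 : ℝ) 1) : 0 < cos (α * (π / 2)) :=
  cos_pos_of_mem_Ioo ⟨by nlinarith [pi_pos, hα.1, hα.2], by nlinarith [pi_pos, hα.1, hα.2]⟩

/-- The factor tan u + i grows like 1/cos u, which is proportional to |z|, and exp(-c|z|^α) beats
|z|. The factor exp(xs/2) is half of what exp(-sx) can absorb, so Fubini will apply. -/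
lemma exists_norm_verticalIntegrand_le {α s : ℝ} (hα : α ∈ Ioo (0 : ℝ) 1) (hs : 0 < s) :
    ∃ M : ℝ, 0 ≤ M ∧ ∀ x u : ℝ, 0 ≤ u → u < π / 2 →
      ‖verticalIntegrand α s x u‖ ≤ M * exp (x * (s / 2)) := by
  have hc := cos_half_pi_mul_pos hα
  obtain ⟨M, hM⟩ := exists_linear_sub_exp_le hα.1 hc
  refine ⟨4 / s * exp M, by positivity, fun x u hu0 hu => ?_⟩
  have hcu : 0 < cos u := cos_pos_of_mem_Ioo ⟨by linarith [pi_pos], hu⟩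
  have hE := exp_verticalCurve hs hcu
  have h1 : ‖(tan u + Complex.I : ℂ)‖ ≤ 2 / cos u := by
    refine (norm_add_le _ _).trans ?_
    rw [Complex.norm_real, Complex.norm_I, tan_eq_sin_div_cos, norm_div,
      norm_of_nonneg hcu.le, norm_eq_abs, div_add_one hcu.ne']
    gcongr
    linarith [abs_sin_le_one u, cos_le_one u]
  have hcos : cos (α * (π / 2)) ≤ cos (α * u) :=
    cos_le_cos_of_nonneg_of_le_pi (mul_nonneg hα.1.le hu0)
      (by nlinarith [pi_pos, hα.1, hα.2]) (mul_le_mul_of_nonneg_left hu.le hα.1.le)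
  have h2 : ‖stableKernel α x (verticalCurve s u + u * Complex.I)‖ ≤
      exp (x * (s / 2)) * (exp M / exp (verticalCurve s u)) := by
    rw [norm_stableKernel, ← exp_sub, ← exp_add, exp_le_exp]
    have e : x * exp (verticalCurve s u) * cos u = x * (s / 2) := by
      rw [hE]; field_simp
    have := hM (verticalCurve s u)
    have := mul_le_mul_of_nonneg_left hcos (exp_pos (α * verticalCurve s u)).le
    rw [e]; linarith
  rw [verticalIntegrand, norm_mul]
  calc _ ≤ (exp (x * (s / 2)) * (exp M / exp (verticalCurve s u))) * (2 / cos u) :=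
        mul_le_mul h2 h1 (norm_nonneg _) (by positivity)
    _ = _ := by rw [hE]; field_simp; ring

lemma measurable_verticalIntegrand (α s : ℝ) :
    Measurable (fun p : ℝ × ℝ => verticalIntegrand α s p.1 p.2) := by
  unfold verticalIntegrand stableKernel verticalCurve
  simp only [tan_eq_sin_div_cos]
  fun_prop

/-! ### Moving the contour -/

section Contour

variable {α x : ℝ} {G : ℂ → ℂ}

/-- The kernel is real on the real axis. Both contours start there, so they share one base value of
Im G wherever they start. -/
lemma im_primitive_ofReal (hG : ∀ w, HasDerivAt G (stableKernel α x w) w) (a : ℝ) :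
    (G a).im = (G 0).im := by
  have h : ∀ a : ℝ, HasDerivAt (fun a : ℝ => (G a).im) 0 a := fun a => by
    have := (hG a).comp_ofReal
    have h2 := Complex.imCLM.hasFDerivAt.comp_hasDerivAt a this
    rw [stableKernel_ofReal] at h2
    exact h2.congr_deriv (by rw [Complex.imCLM_apply, Complex.ofReal_im])
  have := is_const_of_deriv_eq_zero (fun a => (h a).differentiableAt) (fun a => (h a).deriv) a 0
  simpa using this

lemma hasDerivAt_im_primitive_graph (hG : ∀ w, HasDerivAt G (stableKernel α x w) w)
    {h : ℝ → ℝ} {d u : ℝ} (hd : HasDerivAt h d u) :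
    HasDerivAt (fun u : ℝ => (G (h u + u * Complex.I)).im)
      (stableKernel α x (h u + u * Complex.I) * (d + Complex.I)).im u := by
  have h1 : HasDerivAt (fun u : ℝ => (h u : ℂ) + u * Complex.I) (d + 1 * Complex.I) u :=
    hd.ofReal_comp.add ((Complex.ofRealCLM.hasDerivAt (x := u)).mul_const Complex.I)
  have h2 := (hG (h u + u * Complex.I)).comp u h1
  have h3 := Complex.imCLM.hasFDerivAt.comp_hasDerivAt u h2
  exact h3.congr_deriv (by simp)

/-- A vertical segment in w is an arc of the circle |z| = exp R; such an arc will join the two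
contours far out. -/
lemma norm_primitive_sub_le (hG : ∀ w, HasDerivAt G (stableKernel α x w) w) {R v u B : ℝ}
    (hvu : v ≤ u) (hB : ∀ t ∈ Icc v u, ‖stableKernel α x (R + t * Complex.I)‖ ≤ B) :
    ‖G (R + u * Complex.I) - G (R + v * Complex.I)‖ ≤ B * (u - v) := by
  have h1 : ∀ t : ℝ, HasDerivAt (fun t : ℝ => G (R + t * Complex.I))
      (stableKernel α x (R + t * Complex.I) * Complex.I) t := fun t => by
    have h1 : HasDerivAt (fun u : ℝ => (R : ℂ) + u * Complex.I) (1 * Complex.I) t :=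
      ((Complex.ofRealCLM.hasDerivAt (x := t)).mul_const Complex.I).const_add _
    exact ((hG (R + t * Complex.I)).comp t h1).congr_deriv (by simp)
  have := (convex_Icc v u).norm_image_sub_le_of_norm_hasDerivWithin_le
    (fun t _ => (h1 t).hasDerivWithinAt) (C := B)
    (fun t ht => by simpa using hB t ht) (left_mem_Icc.2 hvu) (right_mem_Icc.2 hvu)
  rwa [norm_of_nonneg (sub_nonneg.2 hvu)] at this

lemma differentiableAt_kanterCurve {u : ℝ} (hα : α ∈ Ioo (0 : ℝ) 1) (hx : 0 < x)
    (hu : u ∈ Ioo 0 π) : DifferentiableAt ℝ (kanterCurve α x) u := by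
  have h1 := sin_mul_pos_of_mem_Ioo hα hu
  have h3 := sin_pos_of_mem_Ioo hu
  unfold kanterCurve
  refine DifferentiableAt.div_const (DifferentiableAt.log (DifferentiableAt.div ?_ ?_ ?_) ?_) _
  · fun_prop
  · fun_prop
  · exact (mul_pos hx h3).ne'
  · exact (div_pos h1 (mul_pos hx h3)).ne'

lemma hasDerivAt_verticalCurve {s u : ℝ} (hs : 0 < s) (hu : 0 < cos u) :
    HasDerivAt (verticalCurve s) (tan u) u := by
  have h1 : HasDerivAt (fun u => log s - (log 2 + log (cos u))) (-(0 + -sin u / cos u)) u :=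
    (((hasDerivAt_cos u).log hu.ne').const_add (log 2) |>.const_sub (log s)).congr_deriv (by ring)
  have h2 : verticalCurve s =ᶠ[𝓝 u] fun u => log s - (log 2 + log (cos u)) := by
    filter_upwards [continuous_cos.continuousAt.eventually (lt_mem_nhds hu)] with v hv
    rw [verticalCurve, log_div hs.ne' (by positivity), log_mul (by norm_num) hv.ne']
  refine (h1.congr_of_eventuallyEq h2).congr_deriv ?_
  rw [tan_eq_sin_div_cos]; ring

/-- Dividing both sines by u turns 0/0 into a quotient of `sinc`. Only the existence of a finite
limit matters, because Im G is constant on the real axis. -/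
lemma tendsto_kanterCurve_zero (hα : α ∈ Ioo (0 : ℝ) 1) (hx : 0 < x) :
    ∃ a : ℝ, Tendsto (kanterCurve α x) (𝓝[>] 0) (𝓝 a) := by
  refine ⟨log (α * sinc (α * 0) / (x * sinc 0)) / (1 - α), ?_⟩
  have hc : ContinuousAt (fun u => log (α * sinc (α * u) / (x * sinc u)) / (1 - α)) 0 := by
    have h1 : x * sinc 0 ≠ 0 := by simpa using hx.ne'
    have h2 : α * sinc (α * 0) / (x * sinc 0) ≠ 0 := by simpa using ⟨hα.1.ne', hx.ne'⟩
    have h3 : Continuous sinc := continuous_sinc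
    have h4 : ContinuousAt (fun u => α * sinc (α * u) / (x * sinc u)) 0 :=
      ContinuousAt.div (by fun_prop) (by fun_prop) h1
    exact (h4.log h2).div_const _
  refine (hc.tendsto.mono_left nhdsWithin_le_nhds).congr' ?_
  filter_upwards [self_mem_nhdsWithin] with u (hu : 0 < u)
  rw [kanterCurve, sinc_of_ne_zero hu.ne', sinc_of_ne_zero (mul_pos hα.1 hu).ne']
  congr 2
  have := hα.1
  field_simp

lemma tendsto_kanterCurve_pi (hα : α ∈ Ioo (0 : ℝ) 1) (hx : 0 < x) :
    Tendsto (kanterCurve α x) (𝓝[<] π) atTop := by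
  have h0 := (one_sub_mem_Ioo hα).1
  refine Tendsto.atTop_div_const h0 (tendsto_log_atTop.comp ?_)
  have h1 : Tendsto (fun u => sin (α * u)) (𝓝[<] π) (𝓝 (sin (α * π))) :=
    (Continuous.tendsto (by fun_prop) π).mono_left nhdsWithin_le_nhds
  have hp : 0 < sin (α * π) :=
    sin_pos_of_pos_of_lt_pi (mul_pos hα.1 pi_pos) (by nlinarith [pi_pos, hα.2])
  have h2 : Tendsto (fun u => x * sin u) (𝓝[<] π) (𝓝[>] 0) := by
    refine tendsto_nhdsWithin_iff.2 ⟨?_, ?_⟩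
    · have : Tendsto (fun u => x * sin u) (𝓝 π) (𝓝 (x * sin π)) :=
        Continuous.tendsto (by fun_prop) π
      rw [sin_pi, mul_zero] at this
      exact this.mono_left nhdsWithin_le_nhds
    · filter_upwards [Ioo_mem_nhdsLT pi_pos] with u hu
      exact mul_pos hx (sin_pos_of_mem_Ioo hu)
  exact (h1.pos_mul_atTop hp h2.inv_tendsto_nhdsGT_zero).congr fun u => rfl

lemma intervalIntegrable_exp_neg_kanterFun (hα : α ∈ Ioo (0 : ℝ) 1) {y : ℝ} (hy : 0 ≤ y) :
    IntervalIntegrable (fun u => exp (-(kanterFun α u * y))) volume 0 π := by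
  rw [intervalIntegrable_iff_integrableOn_Ioo_of_le pi_pos.le]
  refine Measure.integrableOn_of_bounded (M := 1) (by simp) ?_ ?_
  · exact (Measurable.aestronglyMeasurable (by have := measurable_kanterFun (α := α); fun_prop))
  · filter_upwards [ae_restrict_mem measurableSet_Ioo] with u hu
    rw [norm_of_nonneg (exp_pos _).le, exp_le_one_iff]
    have := mul_nonneg (kanterFun_pos hα hu).le hy
    linarith

lemma intervalIntegrable_verticalIntegrand {s : ℝ} (hα : α ∈ Ioo (0 : ℝ) 1) (hs : 0 < s) :
    IntervalIntegrable (fun u => (verticalIntegrand α s x u).im) volume 0 (π / 2) := by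
  obtain ⟨M, -, hM⟩ := exists_norm_verticalIntegrand_le hα hs
  rw [intervalIntegrable_iff_integrableOn_Ioo_of_le (by positivity)]
  refine Measure.integrableOn_of_bounded (M := M * exp (x * (s / 2))) (by simp) ?_ ?_
  · exact (Complex.measurable_im.comp ((measurable_verticalIntegrand α s).comp
      measurable_prodMk_left)).aestronglyMeasurable
  · filter_upwards [ae_restrict_mem measurableSet_Ioo] with u hu
    exact (Complex.abs_im_le_norm _).trans (hM x u hu.1.le hu.2)

/-- Kanter's integral equals the inversion integral along the line `re z = s / 2`. -/
theorem integral_exp_neg_kanterFun_eq_verticalIntegrand {s : ℝ} (hα : α ∈ Ioo (0 : ℝ) 1)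
    (hx : 0 < x) (hs : 0 < s) :
    ∫ u in (0 : ℝ)..π, exp (-(kanterFun α u * x ^ (-(α / (1 - α))))) =
      ∫ u in (0 : ℝ)..π / 2, (verticalIntegrand α s x u).im := by
  -- An entire primitive replaces Cauchy's theorem: each integral is the limit of Im G along its
  -- contour minus the common value K.
  obtain ⟨G, hG'⟩ := (differentiable_stableKernel α x).isExactOn_univ
  have hG : ∀ w, HasDerivAt G (stableKernel α x w) w := fun w => by
    simpa using hG' w (mem_univ w)
  have hGc : Continuous G := continuous_iff_continuousAt.2 fun w => (hG w).continuousAt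
  set K := (G 0).im
  set f₁ := fun u => exp (-(kanterFun α u * x ^ (-(α / (1 - α)))))
  set f₂ := fun u => (verticalIntegrand α s x u).im
  have hint₁ : IntervalIntegrable f₁ volume 0 π :=
    intervalIntegrable_exp_neg_kanterFun hα (rpow_nonneg hx.le _)
  have hint₂ : IntervalIntegrable f₂ volume 0 (π / 2) :=
    intervalIntegrable_verticalIntegrand hα hs
  set Φ₁ := fun u : ℝ => (G (kanterCurve α x u + u * Complex.I)).im
  set Φ₂ := fun u : ℝ => (G (verticalCurve s u + u * Complex.I)).im
  have hd₁ : ∀ u ∈ Ioo 0 π, HasDerivAt Φ₁ (f₁ u) u := fun u hu => by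
    have := hasDerivAt_im_primitive_graph hG (differentiableAt_kanterCurve hα hx hu).hasDerivAt
    rw [stableKernel_kanterCurve hα hx hu] at this
    simpa only [Complex.im_ofReal_mul, Complex.add_im, Complex.ofReal_im, Complex.I_im, zero_add,
      mul_one] using this
  have hcos : ∀ u, 0 ≤ u → u < π / 2 → 0 < cos u := fun u h0 h =>
    cos_pos_of_mem_Ioo ⟨by linarith [pi_pos], h⟩
  have hd₂ : ∀ u, 0 ≤ u → u < π / 2 → HasDerivAt Φ₂ (f₂ u) u := fun u h0 h => by
    have := hasDerivAt_im_primitive_graph hG (hasDerivAt_verticalCurve hs (hcos u h0 h))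
    simpa [f₂, verticalIntegrand] using this
  have hF₁ : ∀ u ∈ Ioo 0 π, ∫ t in (0 : ℝ)..u, f₁ t = Φ₁ u - K := fun u hu => by
    obtain ⟨a, ha⟩ := tendsto_kanterCurve_zero hα hx
    refine intervalIntegral.integral_eq_sub_of_hasDerivAt_of_tendsto hu.1
      (fun t ht => hd₁ t ⟨ht.1, ht.2.trans hu.2⟩) ?_ ?_ ?_
    · exact hint₁.mono_set (by
        rw [uIcc_of_le hu.1.le, uIcc_of_le pi_pos.le]; exact Icc_subset_Icc_right hu.2.le)
    · have h1 : Tendsto (fun u : ℝ => (kanterCurve α x u : ℂ) + u * Complex.I) (𝓝[>] 0)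
          (𝓝 (a + ((0 : ℝ) : ℂ) * Complex.I)) :=
        ((Complex.continuous_ofReal.tendsto a).comp ha).add
          (((Complex.continuous_ofReal.tendsto 0).mono_left nhdsWithin_le_nhds).mul_const _)
      have h2 := (Complex.continuous_im.comp hGc).continuousAt.tendsto.comp h1
      simp only [Function.comp_def, Complex.ofReal_zero, zero_mul, add_zero,
        im_primitive_ofReal hG] at h2
      exact h2
    · exact ((hd₁ u hu).continuousAt.tendsto).mono_left nhdsWithin_le_nhds
  have hF₂ : ∀ u, 0 < u → u < π / 2 → ∫ t in (0 : ℝ)..u, f₂ t = Φ₂ u - K := fun u h0 h => by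
    have : Φ₂ 0 = K := by
      simp only [Φ₂, Complex.ofReal_zero, zero_mul, add_zero, im_primitive_ofReal hG]
      rfl
    rw [← this]
    refine intervalIntegral.integral_eq_sub_of_hasDerivAt (fun t ht => ?_) ?_
    · rw [uIcc_of_le h0.le] at ht
      exact hd₂ t ht.1 (ht.2.trans_lt h)
    · exact hint₂.mono_set (by
        rw [uIcc_of_le h0.le, uIcc_of_le (by positivity)]; exact Icc_subset_Icc_right h.le)
  have hL₁ : Tendsto (fun u => Φ₁ u - K) (𝓝[<] π) (𝓝 (∫ t in (0 : ℝ)..π, f₁ t)) := by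
    have h1 := intervalIntegral.continuousOn_primitive_interval' hint₁ left_mem_uIcc
    rw [uIcc_of_le pi_pos.le] at h1
    have h2 := (h1 π (right_mem_Icc.2 pi_pos.le)).mono_left
      (nhdsWithin_mono _ (Ioo_subset_Icc_self))
    rw [nhdsWithin_Ioo_eq_nhdsLT pi_pos] at h2
    refine Tendsto.congr' ?_ h2
    filter_upwards [Ioo_mem_nhdsLT pi_pos] with u hu using hF₁ u hu
  have hπ2 : (0 : ℝ) < π / 2 := by positivity
  have hL₂ : Tendsto (fun u => Φ₂ u - K) (𝓝[<] (π / 2))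
      (𝓝 (∫ t in (0 : ℝ)..π / 2, f₂ t)) := by
    have h1 := intervalIntegral.continuousOn_primitive_interval' hint₂ left_mem_uIcc
    rw [uIcc_of_le hπ2.le] at h1
    have h2 := (h1 (π / 2) (right_mem_Icc.2 hπ2.le)).mono_left
      (nhdsWithin_mono _ (Ioo_subset_Icc_self))
    rw [nhdsWithin_Ioo_eq_nhdsLT hπ2] at h2
    refine Tendsto.congr' ?_ h2
    filter_upwards [Ioo_mem_nhdsLT hπ2] with u hu using hF₂ u hu.1 hu.2
  have hR := tendsto_kanterCurve_pi hα hx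
  -- The angle arccos(ρ u) is where the line Re z = s/2 has the same modulus as Kanter's curve at
  -- angle u.
  set ρ := fun u => s / 2 * exp (-kanterCurve α x u)
  have hρ : Tendsto ρ (𝓝[<] π) (𝓝 0) := by
    simpa using (tendsto_exp_neg_atTop_nhds_zero.comp hR).const_mul (s / 2)
  have hρ0 : ∀ u, 0 < ρ u := fun u => by positivity
  have hv : Tendsto (fun u => arccos (ρ u)) (𝓝[<] π) (𝓝[<] (π / 2)) := by
    refine tendsto_nhdsWithin_iff.2 ⟨?_, Eventually.of_forall fun u => ?_⟩
    · have := (continuous_arccos.tendsto 0).comp hρ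
      rwa [arccos_zero] at this
    · exact arccos_lt_pi_div_two.2 (hρ0 u)
  have hL₂' := hL₂.comp hv
  obtain ⟨B, hB0, hB⟩ := exists_bound_stableKernel hα hx (s / 2)
  -- The arc between the two endpoints lies in Re z ≤ s/2 and has angular length at most π, so the
  -- kernel bound B makes its contribution vanish.
  have hdiff : Tendsto (fun u => (Φ₁ u - K) - (Φ₂ (arccos (ρ u)) - K)) (𝓝[<] π) (𝓝 0) := by
    have hz : Tendsto (fun u => B (kanterCurve α x u) * π) (𝓝[<] π) (𝓝 0) := by
      simpa using (hB0.comp hR).mul_const π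
    refine squeeze_zero_norm' ?_ hz
    filter_upwards [Ioo_mem_nhdsLT pi_pos, hρ.eventually (ge_mem_nhds one_pos),
      (tendsto_id.mono_left nhdsWithin_le_nhds : Tendsto id (𝓝[<] π) (𝓝 π)).eventually
        (lt_mem_nhds (half_lt_self pi_pos))] with u hu h1 hu2
    have hcosv : cos (arccos (ρ u)) = ρ u := cos_arccos (by linarith [hρ0 u]) h1
    have hcv : verticalCurve s (arccos (ρ u)) = kanterCurve α x u := by
      rw [verticalCurve, hcosv, ← log_exp (kanterCurve α x u)]
      congr 1
      simp only [ρ, exp_neg]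
      field_simp
    have hvu : arccos (ρ u) ≤ u := (arccos_lt_pi_div_two.2 (hρ0 u)).le.trans hu2.le
    have hv0 := arccos_nonneg (ρ u)
    have hbd : ∀ t ∈ Icc (arccos (ρ u)) u,
        ‖stableKernel α x (kanterCurve α x u + t * Complex.I)‖ ≤ B (kanterCurve α x u) := by
      intro t ht
      refine hB _ t (hv0.trans ht.1) (ht.2.trans hu.2.le) ?_
      have := cos_le_cos_of_nonneg_of_le_pi hv0 (ht.2.trans hu.2.le) ht.1
      rw [hcosv] at this
      calc exp (kanterCurve α x u) * cos t ≤ exp (kanterCurve α x u) * ρ u := by gcongr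
        _ = s / 2 := by simp only [ρ, exp_neg]; field_simp
    have h3 := norm_primitive_sub_le hG hvu hbd
    have hB' : 0 ≤ B (kanterCurve α x u) :=
      (norm_nonneg _).trans (hbd u (right_mem_Icc.2 hvu))
    have h4 : (Φ₁ u - K) - (Φ₂ (arccos (ρ u)) - K) =
        (G (kanterCurve α x u + u * Complex.I) -
          G (kanterCurve α x u + arccos (ρ u) * Complex.I)).im := by
      simp only [Φ₁, Φ₂, hcv, Complex.sub_im]
      ring
    rw [h4]
    refine (Complex.abs_im_le_norm _).trans (h3.trans ?_)
    exact mul_le_mul_of_nonneg_left (by linarith [hu.2]) hB'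
  have := tendsto_nhds_unique hdiff (hL₁.sub hL₂')
  linarith

end Contour

/-! ### The Poisson integral through the unit disc -/

/-- `exp (-z ^ α)` along the line `re z = s / 2`, in the argument `u` of `z`. -/
noncomputable def verticalCharFun (α s u : ℝ) : ℂ :=
  Complex.exp (-Complex.exp (α * (verticalCurve s u + u * Complex.I)))

lemma verticalCharFun_neg (α s u : ℝ) :
    (verticalCharFun α s (-u)).re = (verticalCharFun α s u).re := by
  have : verticalCharFun α s (-u) = (starRingEnd ℂ) (verticalCharFun α s u) := by
    simp [verticalCharFun, verticalCurve, ← Complex.exp_conj]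
  rw [this, Complex.conj_re]

/-- `exp (-z ^ α)` transported from the half-plane `re z > s / 2` to the unit disc. -/
noncomputable def discCharFun (α s : ℝ) (ζ : ℂ) : ℂ :=
  -- The point ζ = 1 corresponds to z = ∞, where the function tends to 0; division by zero in the
  -- formula would give the value 1 for α ≠ 0.
  if ζ = 1 then 0 else Complex.exp (-(s / (1 - ζ)) ^ (α : ℂ))

lemma norm_exp_neg_cpow_le {α : ℝ} (hα : α ∈ Ioo (0 : ℝ) 1) {z : ℂ} (hz : 0 < z.re) :
    ‖Complex.exp (-z ^ (α : ℂ))‖ ≤ exp (-(cos (α * (π / 2)) * ‖z‖ ^ α)) := by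
  have hz0 : z ≠ 0 := fun h => by simp [h] at hz
  have harg := (Complex.abs_arg_lt_pi_div_two_iff.2 (Or.inl hz)).le
  rw [Complex.norm_exp, exp_le_exp, Complex.neg_re, neg_le_neg_iff]
  have h1 : (z ^ (α : ℂ)).re = ‖z‖ ^ α * cos (α * z.arg) := by
    rw [Complex.cpow_def_of_ne_zero hz0, Complex.exp_re, Complex.re_mul_ofReal,
      Complex.im_mul_ofReal, Complex.log_re, Complex.log_im, mul_comm z.arg,
      rpow_def_of_pos (norm_pos_iff.2 hz0)]
  rw [h1, mul_comm]
  refine mul_le_mul_of_nonneg_left ?_ (by positivity)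
  rw [← cos_abs (α * z.arg), abs_mul, abs_of_pos hα.1]
  exact cos_le_cos_of_nonneg_of_le_pi (mul_nonneg hα.1.le (abs_nonneg _))
    (by nlinarith [pi_pos, hα.1, hα.2]) (mul_le_mul_of_nonneg_left harg hα.1.le)

lemma re_div_one_sub_pos {s : ℝ} (hs : 0 < s) {ζ : ℂ} (hζ : ‖ζ‖ ≤ 1) (h1 : ζ ≠ 1) :
    0 < ((s : ℂ) / (1 - ζ)).re := by
  have h2 : 0 < (1 - ζ).re := by
    have hre : ζ.re ≤ 1 := (Complex.re_le_norm ζ).trans hζ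
    rcases hre.lt_or_eq with h | h
    · simpa using h
    · exfalso
      apply h1
      have := Complex.normSq_eq_norm_sq ζ
      rw [Complex.normSq_apply, h] at this
      apply Complex.ext
      · simpa using h
      · simp only [Complex.one_im]; nlinarith [norm_nonneg ζ]
  have h3 : 0 < Complex.normSq (1 - ζ) :=
    Complex.normSq_pos.2 fun h => by rw [h] at h2; simp at h2
  rw [div_eq_mul_inv, Complex.re_ofReal_mul, Complex.inv_re]
  positivity

/-- Only continuity at ζ = 1 is delicate; it follows from the decay of exp(-z^α) as |z| = s/|1-ζ|
tends to infinity within the half-plane. -/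
lemma diffContOnCl_discCharFun {α s : ℝ} (hα : α ∈ Ioo (0 : ℝ) 1) (hs : 0 < s) :
    DiffContOnCl ℂ (discCharFun α s) (Metric.ball 0 1) := by
  have hd : ∀ ζ : ℂ, ‖ζ‖ ≤ 1 → ζ ≠ 1 → DifferentiableAt ℂ (discCharFun α s) ζ := by
    intro ζ hζ h1
    have h2 := re_div_one_sub_pos hs hζ h1
    have h3 : DifferentiableAt ℂ (fun ζ : ℂ => Complex.exp (-(s / (1 - ζ)) ^ (α : ℂ))) ζ := by
      have h4 : DifferentiableAt ℂ (fun ζ : ℂ => (s : ℂ) / (1 - ζ)) ζ :=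
        (differentiableAt_const _).div (by fun_prop) (sub_ne_zero.2 h1.symm)
      exact (DifferentiableAt.cpow_const (c := (α : ℂ)) h4 (Or.inl h2)).neg.cexp
    refine h3.congr_of_eventuallyEq ?_
    filter_upwards [isOpen_ne.mem_nhds h1] with w hw
    rw [discCharFun, if_neg hw]
  refine ⟨fun ζ hζ => (hd ζ ?_ ?_).differentiableWithinAt, ?_⟩
  · exact (mem_ball_zero_iff.1 hζ).le
  · rintro rfl; simp at hζ
  rw [closure_ball _ one_ne_zero]
  intro ζ hζ
  rw [mem_closedBall_zero_iff] at hζ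
  by_cases h1 : ζ = 1
  swap
  · exact (hd ζ hζ h1).continuousAt.continuousWithinAt
  subst h1
  have hc := cos_half_pi_mul_pos hα
  have hmem : (1 : ℂ) ∈ Metric.closedBall (0 : ℂ) 1 := by simp
  rw [← insert_sdiff_self_of_mem hmem, continuousWithinAt_insert_self, ContinuousWithinAt,
    show discCharFun α s 1 = 0 from if_pos rfl]
  have hb : Tendsto (fun ζ : ℂ => exp (-(cos (α * (π / 2)) * (s * ‖1 - ζ‖⁻¹) ^ α)))
      (𝓝[Metric.closedBall 0 1 \ {1}] 1) (𝓝 0) := by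
    have h1 : Tendsto (fun ζ : ℂ => ‖1 - ζ‖) (𝓝[Metric.closedBall 0 1 \ {1}] 1) (𝓝[>] 0) := by
      refine tendsto_nhdsWithin_iff.2 ⟨?_, ?_⟩
      · have : Tendsto (fun ζ : ℂ => ‖1 - ζ‖) (𝓝 1) (𝓝 ‖(1 : ℂ) - 1‖) :=
          Continuous.tendsto (by fun_prop) 1
        rw [sub_self, norm_zero] at this
        exact this.mono_left nhdsWithin_le_nhds
      · filter_upwards [self_mem_nhdsWithin] with ζ hζ
        exact norm_pos_iff.2 (sub_ne_zero.2 (Ne.symm hζ.2))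
    have h2 := ((tendsto_rpow_atTop hα.1).comp
      (h1.inv_tendsto_nhdsGT_zero.const_mul_atTop hs)).const_mul_atTop hc
    exact tendsto_exp_neg_atTop_nhds_zero.comp h2
  refine squeeze_zero_norm' ?_ hb
  filter_upwards [self_mem_nhdsWithin] with ζ hζ
  rw [discCharFun, if_neg (mem_singleton_iff.not.1 hζ.2)]
  refine (norm_exp_neg_cpow_le hα
    (re_div_one_sub_pos hs (mem_closedBall_zero_iff.1 hζ.1) hζ.2)).trans_eq ?_
  rw [norm_div, Complex.norm_real, norm_of_nonneg hs.le, div_eq_mul_inv s]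

/-- Mean value property: the centre ζ = 0 corresponds to z = s. -/
theorem circleAverage_discCharFun {α s : ℝ} (hα : α ∈ Ioo (0 : ℝ) 1) (hs : 0 < s) :
    circleAverage (discCharFun α s) 0 1 = exp (-s ^ α) := by
  rw [DiffContOnCl.circleAverage (by simpa using diffContOnCl_discCharFun hα hs), discCharFun]
  simp [Complex.ofReal_cpow hs.le]

/-- With ζ = -exp(-2iu) one has 1 - ζ = 2 cos u exp(-iu), so z = s/(1-ζ) is the point of argument u
on Re z = s/2. Uniform measure on the circle thus becomes uniform measure in u. -/
lemma discCharFun_circleMap {α s u : ℝ} (hs : 0 < s)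
    (hu : u ∈ Ioo (-(π / 2)) (π / 2)) :
    discCharFun α s (circleMap 0 1 (π - 2 * u)) = verticalCharFun α s u := by
  have hcu : 0 < cos u := cos_pos_of_mem_Ioo hu
  have h1 : circleMap 0 1 (π - 2 * u) = 1 - 2 * cos u * Complex.exp (-(u * Complex.I)) := by
    have e : ((π - 2 * u : ℝ) : ℂ) * Complex.I = π * Complex.I + (-(u * Complex.I)) + (-(u * Complex.I)) := by
      push_cast; ring
    rw [circleMap, e, Complex.exp_add, Complex.exp_add, Complex.exp_pi_mul_I, Complex.ofReal_cos,
      Complex.two_cos]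
    have : Complex.exp (u * Complex.I) * Complex.exp (-(u * Complex.I)) = 1 := by
      rw [← Complex.exp_add]; simp
    have e2 : -(u : ℂ) * Complex.I = -(u * Complex.I) := by ring
    rw [e2]
    push_cast
    linear_combination this
  have h2 : (s : ℂ) / (1 - circleMap 0 1 (π - 2 * u)) =
      Complex.exp (verticalCurve s u + u * Complex.I) := by
    rw [h1, Complex.exp_add, ← Complex.ofReal_exp, exp_verticalCurve hs hcu, Complex.exp_neg]
    have : Complex.exp (u * Complex.I) ≠ 0 := Complex.exp_ne_zero _
    have : (cos u : ℂ) ≠ 0 := by exact_mod_cast hcu.ne'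
    simp only [Complex.ofReal_div, Complex.ofReal_mul, Complex.ofReal_ofNat]
    field_simp
    simp only [sub_sub_cancel]
    field_simp
  have h3 : circleMap 0 1 (π - 2 * u) ≠ 1 := by
    rw [h1]
    have : (cos u : ℂ) ≠ 0 := by exact_mod_cast hcu.ne'
    simpa using this
  rw [discCharFun, if_neg h3, h2, verticalCharFun, Complex.cpow_def_of_ne_zero (Complex.exp_ne_zero _),
    Complex.log_exp, mul_comm]
  · simp; linarith [hu.1, pi_pos]
  · simp; linarith [hu.2, pi_pos]

/-- The Poisson integral of `exp (-z ^ α)` along the line `re z = s / 2`, evaluated at `s`. -/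
theorem integral_verticalCharFun {α s : ℝ} (hα : α ∈ Ioo (0 : ℝ) 1) (hs : 0 < s) :
    ∫ u in (0 : ℝ)..π / 2, (verticalCharFun α s u).re = π / 2 * exp (-s ^ α) := by
  have hci : CircleIntegrable (discCharFun α s) 0 1 := by
    refine ContinuousOn.circleIntegrable zero_le_one ?_
    have := (diffContOnCl_discCharFun hα hs).continuousOn
    rw [closure_ball _ one_ne_zero] at this
    exact this.mono Metric.sphere_subset_closedBall
  set k := fun θ => (discCharFun α s (circleMap 0 1 θ)).re
  have h1 : ∫ θ in (0 : ℝ)..2 * π, k θ = 2 * π * exp (-s ^ α) := by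
    have := circleAverage_discCharFun hα hs
    rw [circleAverage_def] at this
    have h2 := congrArg Complex.re this
    rw [Complex.smul_re, Complex.ofReal_re, smul_eq_mul] at h2
    have h3 := intervalIntegral.intervalIntegral_re (𝕜 := ℂ) hci
    have h4 : ∫ θ in (0 : ℝ)..2 * π, k θ =
      (∫ θ in (0 : ℝ)..2 * π, discCharFun α s (circleMap 0 1 θ)).re := h3
    rw [h4, ← h2]
    field_simp
  have h2 := intervalIntegral.integral_comp_sub_mul (a := -(π / 2)) (b := π / 2) k
    (two_ne_zero (α := ℝ)) π
  rw [show π - 2 * (π / 2) = 0 by ring, show π - 2 * (-(π / 2)) = 2 * π by ring, h1] at h2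
  have hk : EqOn (fun u => k (π - 2 * u)) (fun u => (verticalCharFun α s u).re)
      (Ioo (-(π / 2)) (π / 2)) := fun u hu => by
    simp only [k, discCharFun_circleMap hs hu]
  have h3 : ∫ u in -(π / 2)..π / 2, k (π - 2 * u) =
      ∫ u in -(π / 2)..π / 2, (verticalCharFun α s u).re := by
    rw [intervalIntegral.integral_of_le (by linarith [pi_pos]),
      intervalIntegral.integral_of_le (by linarith [pi_pos]), integral_Ioc_eq_integral_Ioo,
      integral_Ioc_eq_integral_Ioo]
    exact setIntegral_congr_fun measurableSet_Ioo hk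
  have hki : IntervalIntegrable (fun u => (verticalCharFun α s u).re) volume
      (-(π / 2)) (π / 2) := by
    have h5 : IntervalIntegrable k volume 0 (2 * π) := ⟨hci.1.re, hci.2.re⟩
    have h6 : IntervalIntegrable (fun u => k (π - 2 * u)) volume (-(π / 2)) (π / 2) := by
      have := (h5.comp_sub_left π).comp_mul_left (c := 2)
      convert! this.symm using 1 <;> ring
    rw [intervalIntegrable_iff_integrableOn_Ioo_of_le (by linarith [pi_pos])] at h6 ⊢
    exact h6.congr_fun hk measurableSet_Ioo
  have hsub1 : IntervalIntegrable (fun u => (verticalCharFun α s u).re) volume (-(π / 2)) 0 :=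
    hki.mono_set (by
      rw [uIcc_of_le (by linarith [pi_pos]), uIcc_of_le (by linarith [pi_pos])]
      exact Icc_subset_Icc_right (by positivity))
  have hsub2 : IntervalIntegrable (fun u => (verticalCharFun α s u).re) volume 0 (π / 2) :=
    hki.mono_set (by
      rw [uIcc_of_le (by linarith [pi_pos]), uIcc_of_le (by linarith [pi_pos])]
      exact Icc_subset_Icc_left (by linarith [pi_pos]))
  have h4 : ∫ u in -(π / 2)..0, (verticalCharFun α s u).re =
      ∫ u in (0 : ℝ)..π / 2, (verticalCharFun α s u).re := by
    have := intervalIntegral.integral_comp_neg (a := 0) (b := π / 2)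
      (fun u => (verticalCharFun α s u).re)
    simp only [verticalCharFun_neg, neg_zero] at this
    exact this.symm
  rw [h3, ← intervalIntegral.integral_add_adjacent_intervals hsub1 hsub2, h4, smul_eq_mul] at h2
  linarith

/-! ### Kanter's variable and its Laplace transform -/

/-- The uniform distribution on `(0, π)`. -/
noncomputable def uniformAngle : Measure ℝ := ENNReal.ofReal π⁻¹ • volume.restrict (Ioo 0 π)

/-- The standard exponential distribution, as a density on `(0, ∞)`. -/
noncomputable def unitExponential : Measure ℝ :=
  (volume.restrict (Ioi 0)).withDensity fun e => ENNReal.ofReal (exp (-e))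

/-- The joint law of an independent uniform angle and exponential variable. -/
noncomputable def kanterBase : Measure (ℝ × ℝ) := uniformAngle.prod unitExponential

/-- Kanter's representation of the positive stable variable with Laplace transform
`exp (-s ^ α)`. -/
noncomputable def kanterVar (α : ℝ) (p : ℝ × ℝ) : ℝ := (kanterFun α p.1 / p.2) ^ ((1 - α) / α)

lemma unitExponential_Ici {y : ℝ} (hy : 0 ≤ y) :
    unitExponential (Ici y) = ENNReal.ofReal (exp (-y)) := by
  have h : (Ici y ∩ Ioi 0 : Set ℝ) =ᵐ[volume] Ioi y := by
    rcases hy.eq_or_lt with rfl | h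
    · rw [inter_eq_self_of_subset_right Ioi_subset_Ici_self]
      exact EventuallyEq.rfl
    · rw [inter_eq_self_of_subset_left (Ici_subset_Ioi.2 h)]
      exact Ioi_ae_eq_Ici.symm
  rw [unitExponential, withDensity_apply _ measurableSet_Ici,
    Measure.restrict_restrict measurableSet_Ici, setLIntegral_congr h,
    ← ofReal_integral_eq_lintegral_ofReal, integral_exp_neg_Ioi]
  · exact integrableOn_exp_neg_Ioi y
  · exact Eventually.of_forall fun e => (exp_pos _).le

lemma ae_unitExponential_pos : ∀ᵐ e ∂unitExponential, 0 < e :=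
  (withDensity_absolutelyContinuous _ _).ae_le (ae_restrict_mem measurableSet_Ioi)

lemma ae_uniformAngle_mem : ∀ᵐ u ∂uniformAngle, u ∈ Ioo 0 π :=
  Measure.ae_smul_measure (ae_restrict_mem measurableSet_Ioo) _

instance : IsProbabilityMeasure unitExponential := by
  constructor
  have h : unitExponential univ = unitExponential (Ici 0) := by
    refine measure_congr ?_
    filter_upwards [ae_unitExponential_pos] with e he
    exact propext ⟨fun _ => he.le, fun _ => trivial⟩
  rw [h, unitExponential_Ici le_rfl]
  simp

instance : IsProbabilityMeasure uniformAngle := by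
  constructor
  rw [uniformAngle, Measure.smul_apply, Measure.restrict_apply_univ, Real.volume_Ioo, smul_eq_mul,
    ← ENNReal.ofReal_mul (by positivity), sub_zero, inv_mul_cancel₀ pi_ne_zero, ENNReal.ofReal_one]

instance : IsProbabilityMeasure kanterBase := by
  unfold kanterBase; infer_instance

lemma ae_kanterBase_mem : ∀ᵐ p ∂kanterBase, p.1 ∈ Ioo 0 π ∧ 0 < p.2 := by
  have h1 : ∀ᵐ p ∂kanterBase, p.1 ∈ Ioo 0 π :=
    Measure.quasiMeasurePreserving_fst.ae ae_uniformAngle_mem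
  have h2 : ∀ᵐ p ∂kanterBase, 0 < p.2 :=
    Measure.quasiMeasurePreserving_snd.ae ae_unitExponential_pos
  exact h1.and h2

lemma measurable_kanterVar (α : ℝ) : Measurable (kanterVar α) := by
  have := measurable_kanterFun (α := α)
  unfold kanterVar
  fun_prop

lemma integral_uniformAngle (f : ℝ → ℝ) :
    ∫ u, f u ∂uniformAngle = π⁻¹ * ∫ u in Ioo 0 π, f u := by
  rw [uniformAngle, integral_smul_measure, ENNReal.toReal_ofReal (by positivity), smul_eq_mul]

lemma kanterVar_pos {α : ℝ} (hα : α ∈ Ioo (0 : ℝ) 1) {p : ℝ × ℝ} (h1 : p.1 ∈ Ioo 0 π)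
    (h2 : 0 < p.2) : 0 < kanterVar α p :=
  rpow_pos_of_pos (div_pos (kanterFun_pos hα h1) h2) _

lemma kanterVar_le_iff {α : ℝ} (hα : α ∈ Ioo (0 : ℝ) 1) {u e x : ℝ} (hu : u ∈ Ioo 0 π)
    (he : 0 < e) (hx : 0 < x) :
    kanterVar α (u, e) ≤ x ↔ kanterFun α u * x ^ (-(α / (1 - α))) ≤ e := by
  have hA := kanterFun_pos hα hu
  have h0 := (one_sub_mem_Ioo hα).1
  have h1 := hα.1
  have e1 : x = (x ^ (α / (1 - α))) ^ ((1 - α) / α) := by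
    rw [← rpow_mul hx.le, show α / (1 - α) * ((1 - α) / α) = 1 by field_simp, rpow_one]
  have hxp := rpow_pos_of_pos hx (α / (1 - α))
  rw [kanterVar, rpow_neg hx.le]
  conv_lhs => rw [e1]
  rw [rpow_le_rpow_iff (by positivity) hxp.le (by positivity), div_le_iff₀ he,
    ← div_eq_mul_inv, div_le_iff₀ hxp, mul_comm]

/-- Given the angle, the event says that the exponential variable exceeds a threshold y, which has
probability exp(-y). -/
lemma kanterBase_kanterVar_le {α : ℝ} (hα : α ∈ Ioo (0 : ℝ) 1) {x : ℝ} (hx : 0 < x) :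
    kanterBase {p | kanterVar α p ≤ x} =
      ENNReal.ofReal (π⁻¹ * ∫ u in (0 : ℝ)..π, exp (-(kanterFun α u * x ^ (-(α / (1 - α)))))) := by
  have hm : MeasurableSet {p | kanterVar α p ≤ x} :=
    measurableSet_le (measurable_kanterVar α) measurable_const
  have hxp := rpow_pos_of_pos hx (-(α / (1 - α)))
  rw [kanterBase, Measure.prod_apply hm, intervalIntegral.integral_of_le pi_pos.le,
    integral_Ioc_eq_integral_Ioo, ← integral_uniformAngle,
    ofReal_integral_eq_lintegral_ofReal]
  · refine lintegral_congr_ae ?_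
    filter_upwards [ae_uniformAngle_mem] with u hu
    rw [← unitExponential_Ici (mul_pos (kanterFun_pos hα hu) hxp).le]
    refine measure_congr ?_
    filter_upwards [ae_unitExponential_pos] with e he
    exact propext (kanterVar_le_iff hα hu he hx)
  · refine Integrable.of_bound (C := 1) ?_ ?_
    · exact (Measurable.aestronglyMeasurable (by have := measurable_kanterFun (α := α); fun_prop))
    · filter_upwards [ae_uniformAngle_mem] with u hu
      rw [norm_of_nonneg (exp_pos _).le, exp_le_one_iff]
      have := mul_pos (kanterFun_pos hα hu) hxp
      linarith
  · exact Eventually.of_forall fun e => (exp_pos _).le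

/-- Write exp(-sX) as the integral of s exp(-sx) over x ≥ X and apply Tonelli; no density of X is
needed. -/
lemma lintegral_exp_neg_eq {Ω : Type*} [MeasurableSpace Ω] {P : Measure Ω} [SFinite P]
    {X : Ω → ℝ} (hX : Measurable X) (hpos : ∀ᵐ ω ∂P, 0 < X ω) {s : ℝ} (hs : 0 < s) :
    ∫⁻ ω, ENNReal.ofReal (exp (-(s * X ω))) ∂P =
      ∫⁻ x in Ioi 0, ENNReal.ofReal (s * exp (-(s * x))) * P {ω | X ω ≤ x} := by
  have h1 : ∀ᵐ ω ∂P, ENNReal.ofReal (exp (-(s * X ω))) =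
      ∫⁻ x in Ioi 0, ENNReal.ofReal (s * exp (-(s * x))) * (Ici (X ω)).indicator 1 x := by
    filter_upwards [hpos] with ω hω
    have e1 : ∀ x, ENNReal.ofReal (s * exp (-(s * x))) * (Ici (X ω)).indicator 1 x =
        (Ici (X ω)).indicator (fun x => ENNReal.ofReal (s * exp (-(s * x)))) x := fun x => by
      by_cases hx : x ∈ Ici (X ω) <;> simp [hx]
    simp_rw [e1]
    rw [lintegral_indicator measurableSet_Ici, Measure.restrict_restrict measurableSet_Ici,
      inter_eq_self_of_subset_left (Ici_subset_Ioi.2 hω), setLIntegral_congr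
      Ioi_ae_eq_Ici.symm, ← ofReal_integral_eq_lintegral_ofReal, integral_const_mul]
    · congr 1
      have := integral_exp_mul_Ioi (a := -s) (by linarith) (X ω)
      simp only [neg_mul] at this
      rw [this]
      field_simp
    · have := (integrableOn_exp_mul_Ioi (a := -s) (by linarith) (X ω)).const_mul s
      simpa only [neg_mul] using this
    · exact Eventually.of_forall fun e => by positivity
  rw [lintegral_congr_ae h1, lintegral_lintegral_swap]
  · refine lintegral_congr fun x => ?_
    rw [lintegral_const_mul]
    · congr 1
      rw [← lintegral_indicator_one (measurableSet_le hX measurable_const)]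
      refine lintegral_congr fun ω => ?_
      by_cases h : X ω ≤ x <;> simp [h]
    · have : (fun ω => (Ici (X ω)).indicator (1 : ℝ → ENNReal) x) =
          {ω | X ω ≤ x}.indicator 1 := by
        ext ω; by_cases h : X ω ≤ x <;> simp [h]
      rw [this]
      exact measurable_one.indicator (measurableSet_le hX measurable_const)
  · refine AEMeasurable.mul (by fun_prop) ?_
    have : (Function.uncurry fun (ω : Ω) (x : ℝ) => (Ici (X ω)).indicator (1 : ℝ → ENNReal) x) =
        {p : Ω × ℝ | X p.1 ≤ p.2}.indicator 1 := by
      ext p; by_cases h : X p.1 ≤ p.2 <;> simp [h, Function.uncurry]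
    change AEMeasurable (Function.uncurry fun (ω : Ω) (x : ℝ) =>
      (Ici (X ω)).indicator (1 : ℝ → ENNReal) x) _
    rw [this]
    exact (measurable_one.indicator
      (measurableSet_le (hX.comp measurable_fst) measurable_snd)).aemeasurable

/-- The x-integral produces s/(s - z). On the line, z = (s/2)(1 + i tan u), so s(tan u + i) = 2i(s -
z) and the quotient collapses to the constant 2i; this is why the abscissa is s/2. -/
lemma integral_exp_mul_verticalIntegrand {α s u : ℝ} (hs : 0 < s) (hu : u ∈ Ioo 0 (π / 2)) :
    ∫ x in Ioi (0 : ℝ), ((s * exp (-(s * x)) : ℝ) : ℂ) * verticalIntegrand α s x u =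
      2 * Complex.I * verticalCharFun α s u := by
  have hcu : 0 < cos u := cos_pos_of_mem_Ioo ⟨by linarith [hu.1, pi_pos], hu.2⟩
  have hcu' : (cos u : ℂ) ≠ 0 := by exact_mod_cast hcu.ne'
  set z := Complex.exp (verticalCurve s u + u * Complex.I) with hz
  have hz1 : z = s / 2 * (1 + Complex.I * tan u) := by
    rw [hz, Complex.exp_add_mul_I, ← Complex.ofReal_exp, exp_verticalCurve hs hcu,
      Complex.ofReal_tan, Complex.tan_eq_sin_div_cos]
    rw [Complex.ofReal_cos] at hcu'
    push_cast
    field_simp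
  have hre : (z - s).re < 0 := by
    have : (z - s).re = -(s / 2) := by
      rw [hz1]; simp; ring
    linarith
  have e : ∀ x : ℝ, ((s * exp (-(s * x)) : ℝ) : ℂ) * verticalIntegrand α s x u =
      (s * verticalCharFun α s u * (tan u + Complex.I)) * Complex.exp ((z - s) * x) := by
    intro x
    rw [verticalIntegrand, stableKernel, verticalCharFun, ← hz, sub_eq_add_neg, Complex.exp_add,
      sub_mul, sub_eq_add_neg, Complex.exp_add, mul_comm z]
    push_cast
    ring
  simp_rw [e]
  rw [integral_const_mul, integral_exp_mul_complex_Ioi hre]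
  have h2 : z - s ≠ 0 := fun h => by simp [h] at hre
  simp only [Complex.ofReal_zero, mul_zero, Complex.exp_zero]
  have h3 : (s : ℂ) * (tan u + Complex.I) = -(2 * Complex.I * (z - s)) := by
    rw [hz1]
    linear_combination (s * tan u : ℂ) * (Complex.I_sq)
  field_simp
  linear_combination (-verticalCharFun α s u) * h3

/-- The Laplace transform of Kanter's variable. -/
theorem lintegral_exp_neg_kanterVar {α s : ℝ} (hα : α ∈ Ioo (0 : ℝ) 1) (hs : 0 < s) :
    ∫⁻ p, ENNReal.ofReal (exp (-(s * kanterVar α p))) ∂kanterBase =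
      ENNReal.ofReal (exp (-s ^ α)) := by
  have hpos : ∀ᵐ p ∂kanterBase, 0 < kanterVar α p :=
    ae_kanterBase_mem.mono fun p hp => kanterVar_pos hα hp.1 hp.2
  obtain ⟨M, hM0, hM⟩ := exists_norm_verticalIntegrand_le hα hs
  set F : ℝ × ℝ → ℂ := fun q => ((s * exp (-(s * q.1)) : ℝ) : ℂ) * verticalIntegrand α s q.1 q.2
  have hFm : Measurable F := by
    have := measurable_verticalIntegrand α s
    refine Measurable.mul ?_ this
    fun_prop
  -- The line bound leaves the dominating function s M exp(-sx/2), integrable on the product.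
  have hFi : Integrable F
      ((volume.restrict (Ioi 0)).prod (volume.restrict (Ioo 0 (π / 2)))) := by
    have h1 : Integrable (fun q : ℝ × ℝ => (s * M * exp (-(s / 2) * q.1)) * 1)
        ((volume.restrict (Ioi 0)).prod (volume.restrict (Ioo 0 (π / 2)))) :=
      Integrable.mul_prod (f := fun x => s * M * exp (-(s / 2) * x)) (g := fun _ => (1 : ℝ))
        ((integrableOn_exp_mul_Ioi (by linarith) 0).const_mul _) (integrable_const _)
    refine h1.mono' hFm.aestronglyMeasurable ?_
    rw [Measure.prod_restrict]
    filter_upwards [ae_restrict_mem (measurableSet_Ioi.prod measurableSet_Ioo)] with q hq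
    rw [norm_mul, Complex.norm_real, norm_of_nonneg (by positivity), mul_one]
    calc s * exp (-(s * q.1)) * ‖verticalIntegrand α s q.1 q.2‖
        ≤ s * exp (-(s * q.1)) * (M * exp (q.1 * (s / 2))) :=
          mul_le_mul_of_nonneg_left (hM _ _ hq.2.1.le hq.2.2) (by positivity)
      _ = s * M * (exp (-(s * q.1)) * exp (q.1 * (s / 2))) := by ring
      _ = _ := by rw [← exp_add]; ring_nf
  have hinner : ∀ x ∈ Ioi (0 : ℝ),
      s * exp (-(s * x)) *
        (π⁻¹ * ∫ u in (0 : ℝ)..π, exp (-(kanterFun α u * x ^ (-(α / (1 - α)))))) =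
      π⁻¹ * ∫ u in Ioo 0 (π / 2), (F (x, u)).im := by
    intro x hx
    rw [integral_exp_neg_kanterFun_eq_verticalIntegrand hα hx hs,
      intervalIntegral.integral_of_le (by positivity), integral_Ioc_eq_integral_Ioo]
    have : ∀ u, (F (x, u)).im = s * exp (-(s * x)) * (verticalIntegrand α s x u).im := fun u => by
      simp only [F, Complex.im_ofReal_mul]
    simp_rw [this]
    rw [integral_const_mul]
    ring
  have hint : Integrable (fun q => (F q).im)
      ((volume.restrict (Ioi 0)).prod (volume.restrict (Ioo 0 (π / 2)))) := hFi.im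
  have hnn : ∀ x ∈ Ioi (0 : ℝ), 0 ≤ s * exp (-(s * x)) *
        (π⁻¹ * ∫ u in (0 : ℝ)..π, exp (-(kanterFun α u * x ^ (-(α / (1 - α)))))) := by
    intro x hx
    have := intervalIntegral.integral_nonneg (μ := volume) pi_pos.le
      (f := fun u => exp (-(kanterFun α u * x ^ (-(α / (1 - α)))))) fun u _ => (exp_pos _).le
    positivity
  rw [lintegral_exp_neg_eq (measurable_kanterVar α) hpos hs]
  have h2 : ∫⁻ x in Ioi 0, ENNReal.ofReal (s * exp (-(s * x))) *
        kanterBase {p | kanterVar α p ≤ x} =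
      ∫⁻ x in Ioi 0, ENNReal.ofReal (π⁻¹ * ∫ u in Ioo 0 (π / 2), (F (x, u)).im) := by
    refine setLIntegral_congr_fun measurableSet_Ioi fun x hx => ?_
    rw [kanterBase_kanterVar_le hα hx, ← ENNReal.ofReal_mul (by positivity), hinner x hx]
  rw [h2, ← ofReal_integral_eq_lintegral_ofReal]
  · congr 1
    rw [integral_const_mul, integral_integral_swap hint]
    have h3 : ∫ u in Ioo 0 (π / 2), ∫ x in Ioi (0 : ℝ), (F (x, u)).im =
        ∫ u in Ioo 0 (π / 2), 2 * (verticalCharFun α s u).re := by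
      have hsec := hFi.prod_left_ae
      have hsec' : ∀ᵐ u ∂(volume.restrict (Ioo 0 (π / 2))),
        ∫ x in Ioi (0 : ℝ), (F (x, u)).im = 2 * (verticalCharFun α s u).re := by
        filter_upwards [hsec, ae_restrict_mem measurableSet_Ioo] with u hu hmem
        have := integral_im (𝕜 := ℂ) hu
        refine Eq.trans this ?_
        simp only [F]
        rw [integral_exp_mul_verticalIntegrand hs hmem]
        simp
      exact integral_congr_ae hsec'
    rw [h3, integral_const_mul, ← integral_Ioc_eq_integral_Ioo,
      ← intervalIntegral.integral_of_le (by positivity), integral_verticalCharFun hα hs]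
    field_simp
  · exact (hint.integral_prod_left).const_mul _
  · filter_upwards [ae_restrict_mem measurableSet_Ioi] with x hx
    rw [← hinner x hx]
    exact hnn x hx

/-! ### From the Laplace transform to the characteristic function -/

lemma ae_kanterVar_pos {α : ℝ} (hα : α ∈ Ioo (0 : ℝ) 1) : ∀ᵐ p ∂kanterBase, 0 < kanterVar α p :=
  ae_kanterBase_mem.mono fun _ hp => kanterVar_pos hα hp.1 hp.2

lemma mgf_kanterVar {α s : ℝ} (hα : α ∈ Ioo (0 : ℝ) 1) (hs : 0 < s) :
    mgf (kanterVar α) kanterBase (-s) = exp (-s ^ α) := by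
  have hm := measurable_kanterVar α
  rw [mgf, integral_eq_lintegral_of_nonneg_ae (Eventually.of_forall fun p => (exp_pos _).le)
    (by fun_prop)]
  simp only [neg_mul]
  rw [lintegral_exp_neg_kanterVar hα hs, ENNReal.toReal_ofReal (exp_pos _).le]

lemma norm_cexp_mul_kanterVar_le {α : ℝ} (hα : α ∈ Ioo (0 : ℝ) 1) {z : ℂ} (hz : 0 ≤ z.re) :
    ∀ᵐ p ∂kanterBase, ‖Complex.exp (-z * kanterVar α p)‖ ≤ 1 := by
  filter_upwards [ae_kanterVar_pos hα] with p hp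
  rw [Complex.norm_exp, exp_le_one_iff, Complex.re_mul_ofReal, Complex.neg_re]
  nlinarith

/-- Identity theorem: both sides are analytic on Re z > 0 and agree on the positive reals, which
accumulate at 1. -/
lemma complexMGF_kanterVar {α : ℝ} (hα : α ∈ Ioo (0 : ℝ) 1) {z : ℂ} (hz : 0 < z.re) :
    complexMGF (kanterVar α) kanterBase (-z) = Complex.exp (-z ^ (α : ℂ)) := by
  have hm := measurable_kanterVar α
  have hsub : Iio (0 : ℝ) ⊆ integrableExpSet (kanterVar α) kanterBase := by
    intro t ht
    refine Integrable.of_bound (C := 1) (by fun_prop) ?_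
    filter_upwards [ae_kanterVar_pos hα] with p hp
    rw [norm_of_nonneg (exp_pos _).le, exp_le_one_iff]
    have : t < 0 := ht
    nlinarith
  have hint : Iio (0 : ℝ) ⊆ interior (integrableExpSet (kanterVar α) kanterBase) :=
    interior_maximal hsub isOpen_Iio
  have hD : IsOpen {z : ℂ | 0 < z.re} := isOpen_lt continuous_const Complex.continuous_re
  have hf : AnalyticOnNhd ℂ (fun z => complexMGF (kanterVar α) kanterBase (-z))
      {z : ℂ | 0 < z.re} := by
    refine DifferentiableOn.analyticOnNhd (fun z hz => ?_) hD
    refine DifferentiableAt.differentiableWithinAt ?_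
    refine DifferentiableAt.comp z (g := complexMGF (kanterVar α) kanterBase) ?_ (by fun_prop)
    exact (hasDerivAt_complexMGF (hint (by simpa using hz))).differentiableAt
  have hg : AnalyticOnNhd ℂ (fun z : ℂ => Complex.exp (-z ^ (α : ℂ))) {z : ℂ | 0 < z.re} := by
    refine DifferentiableOn.analyticOnNhd (fun z hz => ?_) hD
    exact (DifferentiableAt.cpow_const (c := (α : ℂ)) differentiableAt_id
      (Or.inl hz)).neg.cexp.differentiableWithinAt
  have heq : ∀ s : ℝ, 0 < s → complexMGF (kanterVar α) kanterBase (-(s : ℂ)) =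
      Complex.exp (-(s : ℂ) ^ (α : ℂ)) := fun s hs => by
    rw [← Complex.ofReal_neg, complexMGF_ofReal, mgf_kanterVar hα hs]
    push_cast [Complex.ofReal_cpow hs.le]
    rfl
  have hfreq : ∃ᶠ z in 𝓝[≠] (1 : ℂ), complexMGF (kanterVar α) kanterBase (-z) =
      Complex.exp (-z ^ (α : ℂ)) := by
    have ht : Tendsto (fun s : ℝ => (s : ℂ)) (𝓝[>] 1) (𝓝[≠] 1) := by
      refine tendsto_nhdsWithin_iff.2 ⟨?_, ?_⟩
      · exact (Complex.continuous_ofReal.tendsto 1).mono_left nhdsWithin_le_nhds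
      · filter_upwards [self_mem_nhdsWithin] with s hs
        have : s ≠ 1 := ne_of_gt hs
        simpa using this
    refine ht.frequently (Eventually.frequently ?_)
    filter_upwards [self_mem_nhdsWithin] with s hs
    exact heq s (zero_lt_one.trans hs)
  exact hf.eqOn_of_preconnected_of_frequently_eq hg
    (convex_halfSpace_re_gt 0).isPreconnected (z₀ := 1) (by simp) hfreq hz

/-- The imaginary axis is reached from ε - iy as ε → 0+, with integrands bounded by 1. For y ≠ 0 the
limit point avoids the branch cut of the power. -/
lemma integral_cexp_mul_I_kanterVar {α : ℝ} (hα : α ∈ Ioo (0 : ℝ) 1) {y : ℝ} (hy : y ≠ 0) :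
    ∫ p, Complex.exp (y * kanterVar α p * Complex.I) ∂kanterBase =
      Complex.exp (-(-(y * Complex.I)) ^ (α : ℂ)) := by
  have hm := measurable_kanterVar α
  have hslit : -((y : ℂ) * Complex.I) ∈ Complex.slitPlane := Or.inr (by simpa using hy)
  have h1 : Tendsto (fun ε : ℝ => Complex.exp (-(ε + -(y * Complex.I)) ^ (α : ℂ))) (𝓝[>] 0)
      (𝓝 (Complex.exp (-(-(y * Complex.I)) ^ (α : ℂ)))) := by
    have hc : ContinuousAt (fun ε : ℝ => Complex.exp (-(ε + -(y * Complex.I)) ^ (α : ℂ))) 0 := by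
      refine ContinuousAt.cexp (ContinuousAt.neg (ContinuousAt.cpow ?_ continuousAt_const ?_))
      · fun_prop
      · simpa using hslit
    have := hc.tendsto
    simp only [Complex.ofReal_zero, zero_add] at this
    exact this.mono_left nhdsWithin_le_nhds
  have h2 : Tendsto (fun ε : ℝ => ∫ p, Complex.exp (-(ε + -(y * Complex.I)) * kanterVar α p)
      ∂kanterBase) (𝓝[>] 0)
      (𝓝 (∫ p, Complex.exp (y * kanterVar α p * Complex.I) ∂kanterBase)) := by
    refine tendsto_integral_filter_of_dominated_convergence (fun _ => 1) ?_ ?_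
      (integrable_const _) ?_
    · exact Eventually.of_forall fun ε => by fun_prop
    · filter_upwards [self_mem_nhdsWithin] with ε hε
      exact norm_cexp_mul_kanterVar_le hα (by simpa using le_of_lt hε)
    · refine Eventually.of_forall fun p => ?_
      have hc : Continuous fun ε : ℝ =>
          Complex.exp (-(ε + -(y * Complex.I)) * kanterVar α p) := by fun_prop
      have := (hc.tendsto 0).mono_left (nhdsWithin_le_nhds (s := Ioi 0))
      convert! this using 3
      simp only [Complex.ofReal_zero, zero_add]
      ring
  refine tendsto_nhds_unique h2 (h1.congr' ?_)
  filter_upwards [self_mem_nhdsWithin] with ε hε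
  rw [← complexMGF_kanterVar hα (by simpa using hε)]
  rfl

/-- The scale relating the Laplace transform `exp (-s ^ α)` to the law `S(α,1,1)`. -/
noncomputable def stableScale (α : ℝ) : ℝ := cos (α * (π / 2)) ^ (-(1 / α))

lemma stableScale_pos {α : ℝ} (hα : α ∈ Ioo (0 : ℝ) 1) : 0 < stableScale α :=
  rpow_pos_of_pos (cos_half_pi_mul_pos hα) _

lemma stableScale_rpow {α : ℝ} (hα : α ∈ Ioo (0 : ℝ) 1) :
    stableScale α ^ α = (cos (α * (π / 2)))⁻¹ := by
  rw [stableScale, ← rpow_mul (cos_half_pi_mul_pos hα).le]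
  have := hα.1.ne'
  rw [show -(1 / α) * α = -1 by field_simp, rpow_neg_one]

/-- The argument of -iy is -sign(y)π/2, so (-iy)^α = |y|^α (cos(απ/2) - i sign(y) sin(απ/2)). The
scale divides this by cos(απ/2), which produces the tangent. -/
lemma neg_mul_I_cpow {α : ℝ} (hα : α ∈ Ioo (0 : ℝ) 1) {x : ℝ} (hx : x ≠ 0) :
    (-(((x * stableScale α : ℝ) : ℂ) * Complex.I)) ^ (α : ℂ) =
      ((|x| ^ α : ℝ) : ℂ) *
        (1 - ((Real.sign x : ℝ) : ℂ) * Complex.I * ((Real.tan (π * α / 2) : ℝ) : ℂ)) := by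
  have hc := stableScale_pos hα
  have hcos := cos_half_pi_mul_pos hα
  have hx' : 0 < |x| := abs_pos.2 hx
  have hsign : |Real.sign x| = 1 ∧ |x| * Real.sign x = x := by
    rcases hx.lt_or_gt with h | h
    · rw [Real.sign_of_neg h, abs_of_neg h]; simp
    · rw [Real.sign_of_pos h, abs_of_pos h]; simp
  have hσ : Real.sign x = 1 ∨ Real.sign x = -1 := eq_or_eq_neg_of_abs_eq hsign.1
  set σ := Real.sign x
  have e1 : -(((x * stableScale α : ℝ) : ℂ) * Complex.I) =
      Complex.exp ((log (|x| * stableScale α) : ℝ) + ((-(σ * (π / 2)) : ℝ) : ℂ) * Complex.I) := by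
    rw [Complex.exp_add_mul_I, ← Complex.ofReal_exp, exp_log (by positivity),
      ← Complex.ofReal_cos, ← Complex.ofReal_sin]
    have h1 : cos (-(σ * (π / 2))) = 0 := by rcases hσ with h | h <;> simp [h]
    have h2 : sin (-(σ * (π / 2))) = -σ := by rcases hσ with h | h <;> simp [h]
    rw [h1, h2]
    have : (x : ℂ) = (|x| : ℝ) * (σ : ℝ) := by exact_mod_cast hsign.2.symm
    push_cast at this ⊢
    rw [this]; ring
  have e2 : -(((x * stableScale α : ℝ) : ℂ) * Complex.I) ≠ 0 := by
    simpa using ⟨hx, hc.ne'⟩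
  rw [Complex.cpow_def_of_ne_zero e2, e1, Complex.log_exp, add_mul, mul_right_comm,
    ← Complex.ofReal_mul, ← Complex.ofReal_mul, Complex.exp_add_mul_I, ← Complex.ofReal_exp,
    ← Complex.ofReal_cos, ← Complex.ofReal_sin, ← rpow_def_of_pos (by positivity),
    mul_rpow hx'.le hc.le, stableScale_rpow hα]
  · have h1 : cos (-(σ * (π / 2)) * α) = cos (α * (π / 2)) := by
      rcases hσ with h | h
      · rw [h, ← cos_neg]; ring_nf
      · rw [h]; ring_nf
    have h2 : sin (-(σ * (π / 2)) * α) = -σ * sin (α * (π / 2)) := by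
      rcases hσ with h | h
      · rw [h, neg_one_mul, ← sin_neg]; ring_nf
      · rw [h]; ring_nf
    have h3 : π * α / 2 = α * (π / 2) := by ring
    have hcC : ((cos (α * (π / 2)) : ℝ) : ℂ) ≠ 0 := by exact_mod_cast hcos.ne'
    rw [h1, h2, h3, tan_eq_sin_div_cos]
    generalize cos (α * (π / 2)) = c at hcC
    simp only [Complex.ofReal_mul, Complex.ofReal_inv, Complex.ofReal_neg, Complex.ofReal_div]
    field_simp
    ring
  · simp only [Complex.add_im, Complex.ofReal_im, Complex.im_ofReal_mul, Complex.I_im]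
    rcases hσ with h | h <;> rw [h] <;> linarith [pi_pos]
  · simp only [Complex.add_im, Complex.ofReal_im, Complex.im_ofReal_mul, Complex.I_im]
    rcases hσ with h | h <;> rw [h] <;> linarith [pi_pos]

/-- The law of the rescaled Kanter variable. -/
noncomputable def kanterLaw (α : ℝ) : Measure ℝ :=
  kanterBase.map fun p => stableScale α * kanterVar α p

/-- Kanter's representation of `S(α,1,1)`. -/
theorem isMaxSkewedStable_kanterLaw {α : ℝ} (hα : α ∈ Ioo (0 : ℝ) 1) :
    IsMaxSkewedStable α (kanterLaw α) := by
  have hm : Measurable fun p => stableScale α * kanterVar α p :=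
    (measurable_kanterVar α).const_mul _
  have hprob : IsProbabilityMeasure (kanterLaw α) :=
    Measure.isProbabilityMeasure_map hm.aemeasurable
  refine ⟨hprob, fun x => ?_⟩
  rcases eq_or_ne x 0 with rfl | hx
  · simp [maxSkewedStableCharFun, zero_rpow hα.1.ne']
  rw [charFun_apply_real, kanterLaw, integral_map hm.aemeasurable (by fun_prop),
    maxSkewedStableCharFun, neg_mul, ← neg_mul_I_cpow hα hx,
    ← integral_cexp_mul_I_kanterVar hα (mul_ne_zero hx (stableScale_pos hα).ne')]
  refine integral_congr_ae (Eventually.of_forall fun p => ?_)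
  simp only
  push_cast
  ring_nf

theorem IsMaxSkewedStable.eq_kanterLaw {α : ℝ} (hα : α ∈ Ioo (0 : ℝ) 1) {μ : Measure ℝ}
    (hμ : IsMaxSkewedStable α μ) : μ = kanterLaw α := by
  have := hμ.isProbabilityMeasure
  have h := isMaxSkewedStable_kanterLaw hα
  have := h.isProbabilityMeasure
  exact Measure.ext_of_charFun (funext fun x => by rw [hμ.charFun_eq, h.charFun_eq])

/-! ### The ratio of two stable variables -/

lemma stableQ_eq {α u₁ u₂ : ℝ} (hα : α ∈ Ioo (0 : ℝ) 1) (h₁ : u₁ ∈ Ioo 0 π)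
    (h₂ : u₂ ∈ Ioo 0 π) : stableQ α u₁ u₂ = kanterFun α u₂ / kanterFun α u₁ := by
  have a1 := sin_mul_pos_of_mem_Ioo hα h₁
  have a2 := sin_mul_pos_of_mem_Ioo hα h₂
  have b1 := sin_mul_pos_of_mem_Ioo (one_sub_mem_Ioo hα) h₁
  have b2 := sin_mul_pos_of_mem_Ioo (one_sub_mem_Ioo hα) h₂
  have c1 := sin_pos_of_mem_Ioo h₁
  have c2 := sin_pos_of_mem_Ioo h₂
  rw [stableQ, kanterFun, kanterFun, div_rpow a2.le a1.le, div_rpow c1.le c2.le,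
    show u₂ - α * u₂ = (1 - α) * u₂ by ring, show u₁ - α * u₁ = (1 - α) * u₁ by ring]
  have := rpow_pos_of_pos a1 (α / (1 - α))
  have := rpow_pos_of_pos c1 (1 / (1 - α))
  have := rpow_pos_of_pos c2 (1 / (1 - α))
  field_simp

lemma stableQ_pos {α u₁ u₂ : ℝ} (hα : α ∈ Ioo (0 : ℝ) 1) (h₁ : u₁ ∈ Ioo 0 π)
    (h₂ : u₂ ∈ Ioo 0 π) : 0 < stableQ α u₁ u₂ := by
  rw [stableQ_eq hα h₁ h₂]
  exact div_pos (kanterFun_pos hα h₂) (kanterFun_pos hα h₁)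

/-- The law of a pair of independent Kanter variables determines the distribution function. -/
lemma ratioCDF_eq {α t : ℝ} (hα : α ∈ Ioo (0 : ℝ) 1) {Ω : Type*} [MeasurableSpace Ω]
    {P : Measure Ω} {S₁ S₂ : Ω → ℝ} (h : IsIIDStablePair α P S₁ S₂) :
    ratioCDF α P S₁ S₂ t = (kanterBase.prod kanterBase).real
      {q | (kanterVar α q.2 / kanterVar α q.1) ^ (α / (1 - α)) ≤ t} := by
  have := h.isProbabilityMeasure
  have hc := stableScale_pos hα
  have hm : Measurable fun p => stableScale α * kanterVar α p :=
    (measurable_kanterVar α).const_mul _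
  have hlaw : P.map (fun ω => (S₁ ω, S₂ ω)) = (kanterBase.prod kanterBase).map
      (Prod.map (fun p => stableScale α * kanterVar α p) fun p => stableScale α * kanterVar α p) := by
    rw [(indepFun_iff_map_prod_eq_prod_map_map h.aemeasurable₁ h.aemeasurable₂).1 h.indep,
      h.law₁.eq_kanterLaw hα, h.law₂.eq_kanterLaw hα, kanterLaw,
      Measure.map_prod_map _ _ hm hm]
  have hset : MeasurableSet {q : ℝ × ℝ | (q.2 / q.1) ^ (α / (1 - α)) ≤ t} :=
    measurableSet_le (by fun_prop) measurable_const
  have h1 : P.real {ω | (S₂ ω / S₁ ω) ^ (α / (1 - α)) ≤ t} =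
      (P.map fun ω => (S₁ ω, S₂ ω)).real {q | (q.2 / q.1) ^ (α / (1 - α)) ≤ t} := by
    rw [measureReal_def, measureReal_def,
      Measure.map_apply_of_aemeasurable (h.aemeasurable₁.prodMk h.aemeasurable₂) hset]
    rfl
  rw [ratioCDF, h1, hlaw, measureReal_def, measureReal_def,
    Measure.map_apply (hm.prodMap hm) hset]
  congr 2
  ext q
  simp only [mem_preimage, mem_ofPred_eq, Prod.map_fst, Prod.map_snd]
  rw [mul_div_mul_left _ _ hc.ne']

lemma ae_kanterBase_prod_mem : ∀ᵐ q ∂kanterBase.prod kanterBase,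
    (q.1.1 ∈ Ioo 0 π ∧ 0 < q.1.2) ∧ (q.2.1 ∈ Ioo 0 π ∧ 0 < q.2.2) := by
  have h1 : ∀ᵐ q ∂kanterBase.prod kanterBase, q.1.1 ∈ Ioo 0 π ∧ 0 < q.1.2 :=
    Measure.quasiMeasurePreserving_fst.ae ae_kanterBase_mem
  have h2 : ∀ᵐ q ∂kanterBase.prod kanterBase, q.2.1 ∈ Ioo 0 π ∧ 0 < q.2.2 :=
    Measure.quasiMeasurePreserving_snd.ae ae_kanterBase_mem
  exact h1.and h2

lemma ratioCDF_zero {α : ℝ} (hα : α ∈ Ioo (0 : ℝ) 1) {Ω : Type*} [MeasurableSpace Ω]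
    {P : Measure Ω} {S₁ S₂ : Ω → ℝ} (h : IsIIDStablePair α P S₁ S₂) :
    ratioCDF α P S₁ S₂ 0 = 0 := by
  rw [ratioCDF_eq hα h, measureReal_def]
  have : (kanterBase.prod kanterBase)
      {q | (kanterVar α q.2 / kanterVar α q.1) ^ (α / (1 - α)) ≤ 0} = 0 := by
    have : ∀ᵐ q ∂kanterBase.prod kanterBase,
        ¬ (kanterVar α q.2 / kanterVar α q.1) ^ (α / (1 - α)) ≤ 0 := by
      filter_upwards [ae_kanterBase_prod_mem] with q hq
      exact not_le.2 (rpow_pos_of_pos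
        (div_pos (kanterVar_pos hα hq.2.1 hq.2.2) (kanterVar_pos hα hq.1.1 hq.1.2)) _)
    simpa [ae_iff] using this
  rw [this, ENNReal.toReal_zero]

/-- The exponents (1-α)/α and α/(1-α) are reciprocal, so the left side is Q e₁/e₂ ≤ t. -/
lemma kanterVar_ratio_le_iff {α t : ℝ} (hα : α ∈ Ioo (0 : ℝ) 1) (ht : 0 < t) {u₁ e₁ u₂ e₂ : ℝ}
    (h₁ : u₁ ∈ Ioo 0 π) (he₁ : 0 < e₁) (h₂ : u₂ ∈ Ioo 0 π) (he₂ : 0 < e₂) :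
    (kanterVar α (u₂, e₂) / kanterVar α (u₁, e₁)) ^ (α / (1 - α)) ≤ t ↔
      e₁ ≤ t / stableQ α u₁ u₂ * e₂ := by
  have hA₁ := kanterFun_pos hα h₁
  have hA₂ := kanterFun_pos hα h₂
  have h0 := (one_sub_mem_Ioo hα).1
  have h1 := hα.1
  rw [kanterVar, kanterVar, ← div_rpow (by positivity) (by positivity),
    ← rpow_mul (by positivity), show (1 - α) / α * (α / (1 - α)) = 1 by field_simp, rpow_one,
    stableQ_eq hα h₁ h₂]
  have e1 : kanterFun α u₂ / e₂ / (kanterFun α u₁ / e₁) =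
      kanterFun α u₂ * e₁ / (e₂ * kanterFun α u₁) := by field_simp
  have e2 : t / (kanterFun α u₂ / kanterFun α u₁) * e₂ =
      t * (e₂ * kanterFun α u₁) / kanterFun α u₂ := by field_simp
  dsimp only
  rw [e1, e2, div_le_iff₀ (by positivity), le_div_iff₀ hA₂, mul_comm (kanterFun α u₂)]

lemma unitExponential_Iic {y : ℝ} (hy : 0 ≤ y) :
    unitExponential (Iic y) = ENNReal.ofReal (1 - exp (-y)) := by
  have h1 : unitExponential {y} = 0 :=
    withDensity_absolutelyContinuous _ _ (by simp)
  have h2 : unitExponential (Iic y) = unitExponential (Iio y) := by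
    refine measure_congr ?_
    have : ∀ᵐ e ∂unitExponential, e ≠ y := by simpa [ae_iff] using h1
    filter_upwards [this] with e he
    exact propext ⟨fun h => lt_of_le_of_ne h he, fun h => le_of_lt h⟩
  rw [h2, ← compl_Ici, prob_compl_eq_one_sub measurableSet_Ici, unitExponential_Ici hy,
    ENNReal.ofReal_sub _ (exp_pos _).le, ENNReal.ofReal_one]

/-- This is Pr(E₁ ≤ c E₂), written so that c = t/Q gives the integrand of the theorem directly. -/
lemma lintegral_unitExponential {c : ℝ} (hc : 0 < c) :
    ∫⁻ e, ENNReal.ofReal (1 - exp (-(c * e))) ∂unitExponential =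
      ENNReal.ofReal (1 / (1 + 1 / c)) := by
  rw [unitExponential, lintegral_withDensity_eq_lintegral_mul _ (by fun_prop) (by fun_prop)]
  have h1 : ∀ e ∈ Ioi (0 : ℝ), ((fun e => ENNReal.ofReal (exp (-e))) *
      fun e => ENNReal.ofReal (1 - exp (-(c * e)))) e =
      ENNReal.ofReal (exp (-1 * e) - exp (-(1 + c) * e)) := fun e _ => by
    rw [Pi.mul_apply, ← ENNReal.ofReal_mul (exp_pos _).le, mul_sub, ← exp_add]
    ring_nf
  rw [setLIntegral_congr_fun measurableSet_Ioi h1, ← ofReal_integral_eq_lintegral_ofReal]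
  · congr 1
    rw [integral_sub (integrableOn_exp_mul_Ioi (by linarith) 0)
      (integrableOn_exp_mul_Ioi (by linarith) 0), integral_exp_mul_Ioi (by linarith),
      integral_exp_mul_Ioi (by linarith)]
    simp only [mul_zero, exp_zero]
    have : -(1 + c) ≠ 0 := by linarith
    have : 1 + c ≠ 0 := by linarith
    have : 1 + 1 / c ≠ 0 := by positivity
    field_simp
    ring
  · exact (integrableOn_exp_mul_Ioi (by linarith) 0).sub (integrableOn_exp_mul_Ioi (by linarith) 0)
  · filter_upwards [ae_restrict_mem measurableSet_Ioi] with e he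
    have : (0 : ℝ) < e := he
    simp only [Pi.zero_apply, sub_nonneg, exp_le_exp]
    nlinarith

lemma measurable_stableQ (α : ℝ) : Measurable fun u : ℝ × ℝ => stableQ α u.1 u.2 := by
  unfold stableQ
  fun_prop

lemma uniformAngle_prod : uniformAngle.prod uniformAngle =
    ENNReal.ofReal (1 / π ^ 2) • volume.restrict (Ioo 0 π ×ˢ Ioo 0 π) := by
  rw [uniformAngle, Measure.prod_smul_left, Measure.prod_smul_right, smul_smul,
    Measure.prod_restrict, ← ENNReal.ofReal_mul (by positivity), Measure.volume_eq_prod]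
  congr 2
  field_simp

lemma ae_uniformAngle_prod_mem : ∀ᵐ u ∂uniformAngle.prod uniformAngle,
    u.1 ∈ Ioo 0 π ∧ u.2 ∈ Ioo 0 π := by
  have h1 : ∀ᵐ u ∂uniformAngle.prod uniformAngle, u.1 ∈ Ioo 0 π :=
    Measure.quasiMeasurePreserving_fst.ae ae_uniformAngle_mem
  have h2 : ∀ᵐ u ∂uniformAngle.prod uniformAngle, u.2 ∈ Ioo 0 π :=
    Measure.quasiMeasurePreserving_snd.ae ae_uniformAngle_mem
  exact h1.and h2

/-- At t = 0 division by zero makes the quotient 1 rather than its limit 0. The bounds survive, but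
the distribution function at 0 needs its own argument, `ratioCDF_zero`. -/
lemma integrand_mem_Icc {q t : ℝ} (hq : 0 ≤ q) (ht : 0 ≤ t) :
    1 / (1 + q / t) ∈ Icc (0 : ℝ) 1 := by
  have : 0 ≤ q / t := by positivity
  exact ⟨by positivity, by rw [div_le_one (by positivity)]; linarith⟩

lemma integrable_integrand {α t : ℝ} (hα : α ∈ Ioo (0 : ℝ) 1) (ht : 0 ≤ t) :
    Integrable (fun u : ℝ × ℝ => 1 / (1 + stableQ α u.1 u.2 / t))
      (uniformAngle.prod uniformAngle) := by
  have := measurable_stableQ α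
  refine Integrable.of_bound (C := 1) (Measurable.aestronglyMeasurable (by fun_prop)) ?_
  filter_upwards [ae_uniformAngle_prod_mem] with u hu
  have := integrand_mem_Icc (stableQ_pos hα hu.1 hu.2).le ht
  rw [norm_of_nonneg this.1]
  exact this.2

/-- The distribution function as an expectation over two independent uniform angles. -/
theorem ratioCDF_eq_integral {α t : ℝ} (hα : α ∈ Ioo (0 : ℝ) 1) (ht : 0 < t) {Ω : Type*}
    [MeasurableSpace Ω] {P : Measure Ω} {S₁ S₂ : Ω → ℝ} (h : IsIIDStablePair α P S₁ S₂) :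
    ratioCDF α P S₁ S₂ t =
      ∫ u, 1 / (1 + stableQ α u.1 u.2 / t) ∂uniformAngle.prod uniformAngle := by
  have hmQ := measurable_stableQ α
  obtain ⟨B, hBdef⟩ : ∃ B : Set ((ℝ × ℝ) × (ℝ × ℝ)),
    B = {q | q.1.2 ≤ t / stableQ α q.1.1 q.2.1 * q.2.2} := ⟨_, rfl⟩
  have hB : MeasurableSet B := by
    have : Measurable fun q : (ℝ × ℝ) × (ℝ × ℝ) => stableQ α q.1.1 q.2.1 := by
      unfold stableQ
      fun_prop
    rw [hBdef]
    exact measurableSet_le measurable_fst.snd ((measurable_const.div this).mul measurable_snd.snd)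
  have h1 : (kanterBase.prod kanterBase)
      {q | (kanterVar α q.2 / kanterVar α q.1) ^ (α / (1 - α)) ≤ t} =
      (kanterBase.prod kanterBase) B := by
    rw [hBdef]
    refine measure_congr ?_
    filter_upwards [ae_kanterBase_prod_mem] with q hq
    exact propext (kanterVar_ratio_le_iff hα ht hq.1.1 hq.1.2 hq.2.1 hq.2.2)
  have h2 : (kanterBase.prod kanterBase) B = ∫⁻ u₂, ∫⁻ e₂, ∫⁻ u₁,
      unitExponential (Iic (t / stableQ α u₁ u₂ * e₂)) ∂uniformAngle ∂unitExponential
        ∂uniformAngle := by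
    rw [Measure.prod_apply_symm hB]
    conv_lhs => rw [kanterBase]
    rw [lintegral_prod]
    · refine lintegral_congr fun u₂ => lintegral_congr fun e₂ => ?_
      change kanterBase _ = _
      rw [kanterBase, Measure.prod_apply (measurable_prodMk_right hB), hBdef]
      rfl
    · exact (measurable_measure_prodMk_right hB).aemeasurable
  have h3 : ∀ u₂ ∈ Ioo 0 π, ∫⁻ e₂, ∫⁻ u₁,
      unitExponential (Iic (t / stableQ α u₁ u₂ * e₂)) ∂uniformAngle ∂unitExponential =
      ∫⁻ u₁, ENNReal.ofReal (1 / (1 + stableQ α u₁ u₂ / t)) ∂uniformAngle := by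
    intro u₂ hu₂
    have hmQ₂ : Measurable fun p : ℝ × ℝ => stableQ α p.2 u₂ := by
      unfold stableQ
      fun_prop
    have e1 : ∫⁻ e₂, ∫⁻ u₁,
        unitExponential (Iic (t / stableQ α u₁ u₂ * e₂)) ∂uniformAngle ∂unitExponential =
        ∫⁻ e₂, ∫⁻ u₁, ENNReal.ofReal (1 - exp (-(t / stableQ α u₁ u₂ * e₂)))
          ∂uniformAngle ∂unitExponential := by
      refine lintegral_congr_ae ?_
      filter_upwards [ae_unitExponential_pos] with e₂ he₂
      refine lintegral_congr_ae ?_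
      filter_upwards [ae_uniformAngle_mem] with u₁ hu₁
      have := stableQ_pos hα hu₁ hu₂
      exact unitExponential_Iic (by positivity)
    rw [e1, lintegral_lintegral_swap (Measurable.aemeasurable (by
      change Measurable fun p : ℝ × ℝ => ENNReal.ofReal (1 - exp (-(t / stableQ α p.2 u₂ * p.1)))
      fun_prop))]
    refine lintegral_congr_ae ?_
    filter_upwards [ae_uniformAngle_mem] with u₁ hu₁
    have := stableQ_pos hα hu₁ hu₂
    rw [lintegral_unitExponential (by positivity), one_div_div]
  rw [ratioCDF_eq hα h, measureReal_def, h1, h2]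
  rw [lintegral_congr_ae (ae_uniformAngle_mem.mono h3)]
  rw [integral_eq_lintegral_of_nonneg_ae, lintegral_prod_symm]
  · exact Measurable.aemeasurable (by fun_prop)
  · filter_upwards [ae_uniformAngle_prod_mem] with u hu
    exact (integrand_mem_Icc (stableQ_pos hα hu.1 hu.2).le ht.le).1
  · exact (integrable_integrand hα ht.le).aestronglyMeasurable

lemma Icc_prod_ae_eq : (Icc 0 π ×ˢ Icc 0 π : Set (ℝ × ℝ)) =ᵐ[volume] Ioo 0 π ×ˢ Ioo 0 π := by
  rw [Measure.volume_eq_prod]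
  exact (Measure.set_prod_ae_eq Ioo_ae_eq_Icc Ioo_ae_eq_Icc).symm

lemma integral_uniformAngle_prod (f : ℝ × ℝ → ℝ) :
    ∫ u, f u ∂uniformAngle.prod uniformAngle =
      1 / π ^ 2 * ∫ u in Icc (0 : ℝ) π ×ˢ Icc (0 : ℝ) π, f u := by
  rw [uniformAngle_prod, integral_smul_measure, ENNReal.toReal_ofReal (by positivity), smul_eq_mul,
    setIntegral_congr_set Icc_prod_ae_eq]

lemma integrableOn_integrand {α t : ℝ} (hα : α ∈ Ioo (0 : ℝ) 1) (ht : 0 ≤ t) :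
    IntegrableOn (fun u : ℝ × ℝ => 1 / (1 + stableQ α u.1 u.2 / t)) (Icc 0 π ×ˢ Icc 0 π) := by
  have h := integrable_integrand hα ht
  rw [uniformAngle_prod, integrable_smul_measure (by simp [pi_pos]) ENNReal.ofReal_ne_top] at h
  exact IntegrableOn.congr_set_ae h Icc_prod_ae_eq

/-! ### Monotonicity of Q through Euler's sine product -/

/-- The contribution to `log (kanterFun α u)` of one factor `1 - x` of Euler's sine product. -/
noncomputable def kanterLogFactor (α x : ℝ) : ℝ :=
  α / (1 - α) * log (1 - α ^ 2 * x) + log (1 - (1 - α) ^ 2 * x) - 1 / (1 - α) * log (1 - x)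

/-- The power series coefficients of `kanterLogFactor`, up to the factor `1 / (m + 1)`. -/
noncomputable def kanterLogCoeff (α : ℝ) (m : ℕ) : ℝ :=
  ∑ j ∈ Finset.range (2 * m + 3), α ^ j - (1 - α) ^ (2 * m + 2)

lemma kanterLogCoeff_nonneg {α : ℝ} (hα : α ∈ Ioo (0 : ℝ) 1) (m : ℕ) :
    0 ≤ kanterLogCoeff α m := by
  have h1 : (1 : ℝ) ≤ ∑ j ∈ Finset.range (2 * m + 3), α ^ j := by
    have := Finset.single_le_sum (f := fun j => α ^ j) (s := Finset.range (2 * m + 3))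
      (fun j _ => pow_nonneg hα.1.le j) (Finset.mem_range.2 (show 0 < 2 * m + 3 by omega))
    simpa using this
  have h2 : (1 - α) ^ (2 * m + 2) ≤ 1 :=
    pow_le_one₀ (by linarith [hα.2]) (by linarith [hα.1])
  unfold kanterLogCoeff
  linarith

/-- The source of all monotonicity in α: the geometric sum increases and the subtracted power
decreases. -/
lemma kanterLogCoeff_mono {α₁ α₂ : ℝ} (h₁ : 0 ≤ α₁) (h : α₁ ≤ α₂) (h₂ : α₂ ≤ 1) (m : ℕ) :
    kanterLogCoeff α₁ m ≤ kanterLogCoeff α₂ m := by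
  unfold kanterLogCoeff
  have h3 : (1 - α₂) ^ (2 * m + 2) ≤ (1 - α₁) ^ (2 * m + 2) :=
    pow_le_pow_left₀ (by linarith) (by linarith) _
  have h4 : ∑ j ∈ Finset.range (2 * m + 3), α₁ ^ j ≤ ∑ j ∈ Finset.range (2 * m + 3), α₂ ^ j :=
    Finset.sum_le_sum fun j _ => pow_le_pow_left₀ h₁ h j
  linarith

/-- Expanding the three logarithms, the coefficient of x^n/n with n = m + 1 is (1 - α^(2n+1))/(1-α)
- (1-α)^(2n); the quotient is a geometric sum of 2n + 1 = 2m + 3 terms. -/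
lemma hasSum_kanterLogFactor {α x : ℝ} (hα : α ∈ Ioo (0 : ℝ) 1) (hx : x ∈ Ico (0 : ℝ) 1) :
    HasSum (fun m : ℕ => kanterLogCoeff α m * (x ^ (m + 1) / (m + 1))) (kanterLogFactor α x) := by
  have key : ∀ c ∈ Icc (0 : ℝ) 1,
      HasSum (fun m : ℕ => (c ^ 2 * x) ^ (m + 1) / (m + 1)) (-log (1 - c ^ 2 * x)) := by
    intro c hc
    apply hasSum_pow_div_log_of_abs_lt_one
    have h1 : c ^ 2 ≤ 1 := pow_le_one₀ hc.1 hc.2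
    rw [abs_of_nonneg (mul_nonneg (sq_nonneg c) hx.1)]
    nlinarith [hx.1, hx.2]
  have h0 := (one_sub_mem_Ioo hα)
  have h1 := (key α ⟨hα.1.le, hα.2.le⟩).mul_left (-(α / (1 - α)))
  have h2 := (key (1 - α) ⟨h0.1.le, h0.2.le⟩).mul_left (-1)
  have h3 := (key 1 (by simp)).mul_left (1 / (1 - α))
  convert! (h1.add h2).add h3 using 1
  · funext m
    have hg := geom_sum_eq hα.2.ne (2 * m + 3)
    rw [kanterLogCoeff, hg]
    have e1 : α - 1 ≠ 0 := by linarith [hα.2]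
    have e2 : 1 - α ≠ 0 := h0.1.ne'
    have e3 : (m : ℝ) + 1 ≠ 0 := by positivity
    have e4 : (α ^ (2 * m + 3) - 1) / (α - 1) = (1 - α ^ (2 * m + 3)) / (1 - α) := by
      rw [← neg_sub 1 α, ← neg_sub 1 (α ^ _), neg_div_neg_eq]
    rw [e4]
    simp only [mul_pow, ← pow_mul, one_pow, one_mul]
    rw [show 2 * m + 3 = 2 * (m + 1) + 1 by ring, show 2 * m + 2 = 2 * (m + 1) by ring, pow_succ]
    field_simp
    ring
  · rw [kanterLogFactor]; ring_nf

lemma kanterLogFactor_sub_le {α₁ α₂ x y : ℝ} (hα₁ : α₁ ∈ Ioo (0 : ℝ) 1)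
    (hα₂ : α₂ ∈ Ioo (0 : ℝ) 1) (h : α₁ ≤ α₂) (hx : 0 ≤ x) (hxy : x ≤ y) (hy : y < 1) :
    kanterLogFactor α₁ y - kanterLogFactor α₁ x ≤ kanterLogFactor α₂ y - kanterLogFactor α₂ x := by
  have hx' : x ∈ Ico (0 : ℝ) 1 := ⟨hx, hxy.trans_lt hy⟩
  have hy' : y ∈ Ico (0 : ℝ) 1 := ⟨hx.trans hxy, hy⟩
  refine hasSum_le (fun m => ?_)
    ((hasSum_kanterLogFactor hα₁ hy').sub (hasSum_kanterLogFactor hα₁ hx'))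
    ((hasSum_kanterLogFactor hα₂ hy').sub (hasSum_kanterLogFactor hα₂ hx'))
  rw [← mul_sub, ← mul_sub]
  refine mul_le_mul_of_nonneg_right (kanterLogCoeff_mono hα₁.1.le h hα₂.2.le m) (sub_nonneg.2 ?_)
  gcongr

lemma kanterLogFactor_mono {α x y : ℝ} (hα : α ∈ Ioo (0 : ℝ) 1) (hx : 0 ≤ x) (hxy : x ≤ y)
    (hy : y < 1) : kanterLogFactor α x ≤ kanterLogFactor α y := by
  refine hasSum_le (fun m => ?_) (hasSum_kanterLogFactor hα ⟨hx, hxy.trans_lt hy⟩)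
    (hasSum_kanterLogFactor hα ⟨hx.trans hxy, hy⟩)
  refine mul_le_mul_of_nonneg_left ?_ (kanterLogCoeff_nonneg hα m)
  gcongr

/-- The argument of the `j`-th factor of Euler's product for `sin u`. -/
noncomputable def eulerArg (u : ℝ) (j : ℕ) : ℝ := (u / π) ^ 2 / ((j : ℝ) + 1) ^ 2

lemma eulerArg_mul (c u : ℝ) (j : ℕ) : eulerArg (c * u) j = c ^ 2 * eulerArg u j := by
  unfold eulerArg; ring

lemma eulerArg_mem {u : ℝ} (hu : u ∈ Ioo 0 π) (j : ℕ) : eulerArg u j ∈ Ico (0 : ℝ) 1 := by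
  have h1 : u / π < 1 := (div_lt_one pi_pos).2 hu.2
  have h0 : 0 < u / π := div_pos hu.1 pi_pos
  refine ⟨by unfold eulerArg; positivity, ?_⟩
  rw [eulerArg, div_lt_one (by positivity)]
  have : (0 : ℝ) ≤ j := by positivity
  nlinarith

lemma eulerArg_mono {u v : ℝ} (hu : 0 ≤ u) (huv : u ≤ v) (j : ℕ) :
    eulerArg u j ≤ eulerArg v j := by
  unfold eulerArg
  have := pi_pos
  gcongr

lemma tendsto_log_sin {u : ℝ} (hu : u ∈ Ioo 0 π) :
    Tendsto (fun n : ℕ => log u + ∑ j ∈ Finset.range n, log (1 - eulerArg u j)) atTop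
      (𝓝 (log (sin u))) := by
  have h := Real.tendsto_euler_sin_prod (u / π)
  have e : π * (u / π) = u := by field_simp
  rw [e] at h
  refine (h.log (sin_pos_of_mem_Ioo hu).ne').congr fun n => ?_
  have hne : ∀ j ∈ Finset.range n, 1 - (u / π) ^ 2 / ((j : ℝ) + 1) ^ 2 ≠ 0 := fun j _ => by
    have := (eulerArg_mem hu j).2
    unfold eulerArg at this
    linarith
  rw [log_mul hu.1.ne' (Finset.prod_ne_zero_iff.2 hne), log_prod hne]
  rfl

lemma log_kanterFun {α u : ℝ} (hα : α ∈ Ioo (0 : ℝ) 1) (hu : u ∈ Ioo 0 π) :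
    log (kanterFun α u) = α / (1 - α) * log (sin (α * u)) + log (sin ((1 - α) * u)) -
      1 / (1 - α) * log (sin u) := by
  have a := sin_mul_pos_of_mem_Ioo hα hu
  have b := sin_mul_pos_of_mem_Ioo (one_sub_mem_Ioo hα) hu
  have c := sin_pos_of_mem_Ioo hu
  have a' := rpow_pos_of_pos a (α / (1 - α))
  have c' := rpow_pos_of_pos c (1 / (1 - α))
  rw [kanterFun, log_div (by positivity) c'.ne', log_mul a'.ne' b.ne', log_rpow a, log_rpow c]

lemma mul_mem_Ioo_zero_pi {c u : ℝ} (hc : c ∈ Ioo (0 : ℝ) 1) (hu : u ∈ Ioo 0 π) :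
    c * u ∈ Ioo 0 π :=
  ⟨mul_pos hc.1 hu.1, by nlinarith [hc.1, hc.2, hu.1, hu.2]⟩

/-- The three log u terms cancel because α/(1-α) + 1 = 1/(1-α). What remains outside the sum does
not depend on u, so it drops out of Q. -/
lemma tendsto_log_kanterFun {α u : ℝ} (hα : α ∈ Ioo (0 : ℝ) 1) (hu : u ∈ Ioo 0 π) :
    Tendsto (fun n : ℕ => α / (1 - α) * log α + log (1 - α) +
      ∑ j ∈ Finset.range n, kanterLogFactor α (eulerArg u j)) atTop
      (𝓝 (log (kanterFun α u))) := by
  have h0 := one_sub_mem_Ioo hα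
  rw [log_kanterFun hα hu]
  refine ((((tendsto_log_sin (mul_mem_Ioo_zero_pi hα hu)).const_mul (α / (1 - α))).add
    (tendsto_log_sin (mul_mem_Ioo_zero_pi h0 hu))).sub
    ((tendsto_log_sin hu).const_mul (1 / (1 - α)))).congr fun n => ?_
  simp only [kanterLogFactor, Finset.sum_add_distrib, Finset.sum_sub_distrib, ← Finset.mul_sum,
    eulerArg_mul]
  rw [log_mul hα.1.ne' hu.1.ne', log_mul h0.1.ne' hu.1.ne']
  have : 1 - α ≠ 0 := h0.1.ne'
  field_simp
  ring

lemma tendsto_log_stableQ {α u v : ℝ} (hα : α ∈ Ioo (0 : ℝ) 1) (hu : u ∈ Ioo 0 π)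
    (hv : v ∈ Ioo 0 π) :
    Tendsto (fun n : ℕ => ∑ j ∈ Finset.range n,
      (kanterLogFactor α (eulerArg v j) - kanterLogFactor α (eulerArg u j))) atTop
      (𝓝 (log (stableQ α u v))) := by
  rw [stableQ_eq hα hu hv, log_div (kanterFun_pos hα hv).ne' (kanterFun_pos hα hu).ne']
  refine ((tendsto_log_kanterFun hα hv).sub (tendsto_log_kanterFun hα hu)).congr fun n => ?_
  rw [Finset.sum_sub_distrib]
  ring

/-- The ratio `Q_α` increases with `α` above the diagonal. -/
theorem stableQ_mono {α₁ α₂ u v : ℝ} (hα₁ : α₁ ∈ Ioo (0 : ℝ) 1) (hα₂ : α₂ ∈ Ioo (0 : ℝ) 1)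
    (h : α₁ ≤ α₂) (hu : u ∈ Ioo 0 π) (hv : v ∈ Ioo 0 π) (huv : u ≤ v) :
    stableQ α₁ u v ≤ stableQ α₂ u v := by
  rw [← log_le_log_iff (stableQ_pos hα₁ hu hv) (stableQ_pos hα₂ hu hv)]
  refine le_of_tendsto_of_tendsto' (tendsto_log_stableQ hα₁ hu hv) (tendsto_log_stableQ hα₂ hu hv)
    fun n => Finset.sum_le_sum fun j _ => ?_
  exact kanterLogFactor_sub_le hα₁ hα₂ h (eulerArg_mem hu j).1 (eulerArg_mono hu.1.le huv j)
    (eulerArg_mem hv j).2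

theorem one_le_stableQ {α u v : ℝ} (hα : α ∈ Ioo (0 : ℝ) 1) (hu : u ∈ Ioo 0 π)
    (hv : v ∈ Ioo 0 π) (huv : u ≤ v) : 1 ≤ stableQ α u v := by
  rw [← log_le_log_iff one_pos (stableQ_pos hα hu hv), log_one]
  refine ge_of_tendsto' (tendsto_log_stableQ hα hu hv)
    fun n => Finset.sum_nonneg fun j _ => sub_nonneg.2 ?_
  exact kanterLogFactor_mono hα (eulerArg_mem hu j).1 (eulerArg_mono hu.1.le huv j)
    (eulerArg_mem hv j).2

lemma stableQ_swap {α u v : ℝ} (hα : α ∈ Ioo (0 : ℝ) 1) (hu : u ∈ Ioo 0 π)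
    (hv : v ∈ Ioo 0 π) : stableQ α v u = (stableQ α u v)⁻¹ := by
  rw [stableQ_eq hα hu hv, stableQ_eq hα hv hu, inv_div]

/-! ### Symmetrization and the inequalities in α -/

/-- The difference of the two sides has the sign of (r - q)(1 - t²)(qr - 1); this is where t ≤ 1
enters. -/
lemma symmetrized_mono {t q r : ℝ} (ht : 0 < t) (ht1 : t ≤ 1) (hq : 1 ≤ q) (hqr : q ≤ r) :
    1 / (1 + q / t) + 1 / (1 + q⁻¹ / t) ≤ 1 / (1 + r / t) + 1 / (1 + r⁻¹ / t) := by
  have hq0 : 0 < q := by linarith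
  have hr0 : 0 < r := by linarith
  have e : ∀ z : ℝ, 0 < z → 1 / (1 + z / t) + 1 / (1 + z⁻¹ / t) = t / (t + z) + t * z / (t * z + 1) :=
    fun z hz => by field_simp
  rw [e q hq0, e r hr0, ← sub_nonneg]
  have : t / (t + r) + t * r / (t * r + 1) - (t / (t + q) + t * q / (t * q + 1)) =
      t * (r - q) * ((1 - t ^ 2) * (q * r - 1)) /
        ((t + q) * (t + r) * ((t * q + 1) * (t * r + 1))) := by
    field_simp
    ring
  rw [this]
  have h1 : 0 ≤ 1 - t ^ 2 := by nlinarith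
  have h2 : 0 ≤ q * r - 1 := by nlinarith
  have h3 : 0 ≤ r - q := by linarith
  positivity

lemma two_mul_integral_eq {α t : ℝ} (hα : α ∈ Ioo (0 : ℝ) 1) (ht : 0 ≤ t) :
    2 * ∫ u, 1 / (1 + stableQ α u.1 u.2 / t) ∂uniformAngle.prod uniformAngle =
      ∫ u, (1 / (1 + stableQ α u.1 u.2 / t) + 1 / (1 + stableQ α u.2 u.1 / t))
        ∂uniformAngle.prod uniformAngle := by
  have h := integrable_integrand hα ht
  have hs : Integrable (fun u : ℝ × ℝ => 1 / (1 + stableQ α u.2 u.1 / t))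
    (uniformAngle.prod uniformAngle) := h.swap
  rw [integral_add h hs, two_mul]
  congr 1
  exact (integral_prod_swap (μ := uniformAngle) (ν := uniformAngle)
    (fun u : ℝ × ℝ => 1 / (1 + stableQ α u.1 u.2 / t))).symm

theorem integral_integrand_mono {α₁ α₂ t : ℝ} (hα₁ : α₁ ∈ Ioo (0 : ℝ) 1)
    (hα₂ : α₂ ∈ Ioo (0 : ℝ) 1) (h : α₁ ≤ α₂) (ht : 0 < t) (ht1 : t ≤ 1) :
    ∫ u, 1 / (1 + stableQ α₁ u.1 u.2 / t) ∂uniformAngle.prod uniformAngle ≤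
      ∫ u, 1 / (1 + stableQ α₂ u.1 u.2 / t) ∂uniformAngle.prod uniformAngle := by
  have hs : ∀ {α : ℝ}, α ∈ Ioo (0 : ℝ) 1 → Integrable (fun u : ℝ × ℝ =>
      1 / (1 + stableQ α u.1 u.2 / t) + 1 / (1 + stableQ α u.2 u.1 / t))
      (uniformAngle.prod uniformAngle) := fun hα =>
    (integrable_integrand hα ht.le).add (integrable_integrand hα ht.le).swap
  have key : ∀ u v, u ∈ Ioo 0 π → v ∈ Ioo 0 π → u ≤ v →
      1 / (1 + stableQ α₁ u v / t) + 1 / (1 + stableQ α₁ v u / t) ≤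
      1 / (1 + stableQ α₂ u v / t) + 1 / (1 + stableQ α₂ v u / t) := fun u v hu hv huv => by
    rw [stableQ_swap hα₁ hu hv, stableQ_swap hα₂ hu hv]
    exact symmetrized_mono ht ht1 (one_le_stableQ hα₁ hu hv huv)
      (stableQ_mono hα₁ hα₂ h hu hv huv)
  have := integral_mono_ae (hs hα₁) (hs hα₂) (by
    filter_upwards [ae_uniformAngle_prod_mem] with u hu
    rcases le_total u.1 u.2 with h | h
    · exact key _ _ hu.1 hu.2 h
    · have := key _ _ hu.2 hu.1 h
      linarith)
  rw [← two_mul_integral_eq hα₁ ht.le, ← two_mul_integral_eq hα₂ ht.le] at this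
  linarith

theorem le_integral_integrand {α t : ℝ} (hα : α ∈ Ioo (0 : ℝ) 1) (ht : 0 < t) (ht1 : t ≤ 1) :
    t / (1 + t) ≤ ∫ u, 1 / (1 + stableQ α u.1 u.2 / t) ∂uniformAngle.prod uniformAngle := by
  have hs : Integrable (fun u : ℝ × ℝ =>
      1 / (1 + stableQ α u.1 u.2 / t) + 1 / (1 + stableQ α u.2 u.1 / t))
      (uniformAngle.prod uniformAngle) :=
    (integrable_integrand hα ht.le).add (integrable_integrand hα ht.le).swap
  have key : ∀ u v, u ∈ Ioo 0 π → v ∈ Ioo 0 π → u ≤ v →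
      2 * (t / (1 + t)) ≤ 1 / (1 + stableQ α u v / t) + 1 / (1 + stableQ α v u / t) :=
    fun u v hu hv huv => by
    rw [stableQ_swap hα hu hv]
    -- Comparison with q = 1, where the symmetrized integrand equals 2t/(1+t).
    refine le_trans (le_of_eq ?_) (symmetrized_mono ht ht1 le_rfl (one_le_stableQ hα hu hv huv))
    field_simp
    ring
  have := integral_mono_ae (integrable_const (2 * (t / (1 + t)))) hs (by
    filter_upwards [ae_uniformAngle_prod_mem] with u hu
    rcases le_total u.1 u.2 with h | h
    · exact key _ _ hu.1 hu.2 h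
    · have := key _ _ hu.2 hu.1 h
      linarith)
  rw [← two_mul_integral_eq hα ht.le, integral_const] at this
  simp only [probReal_univ, one_smul] at this
  linarith

/-! ### The limit α → 0+ -/

/-- Rewritten with `sinc`, the ratio sin(αv)/sin(αu) extends continuously to α = 0 with value v/u;
its exponent tends to 0, and the other two factors cancel in the limit. -/
lemma tendsto_stableQ_zero {u v : ℝ} (hu : u ∈ Ioo 0 π) (hv : v ∈ Ioo 0 π) :
    Tendsto (fun α => stableQ α u v) (𝓝[>] 0) (𝓝 1) := by
  have c1 := sin_pos_of_mem_Ioo hu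
  have c2 := sin_pos_of_mem_Ioo hv
  have hsc : Continuous sinc := continuous_sinc
  have hb : ContinuousAt (fun α : ℝ => v * sinc (α * v) / (u * sinc (α * u))) 0 :=
    ContinuousAt.div (by fun_prop) (by fun_prop) (by simpa using hu.1.ne')
  have hc : ContinuousAt (fun α : ℝ => (v * sinc (α * v) / (u * sinc (α * u))) ^ (α / (1 - α)) *
      (sin u / sin v) ^ (1 / (1 - α)) * (sin (v - α * v) / sin (u - α * u))) 0 := by
    refine ContinuousAt.mul (ContinuousAt.mul ?_ ?_) ?_
    · refine hb.rpow (ContinuousAt.div (by fun_prop) (by fun_prop) (by simp)) (Or.inl ?_)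
      simpa using ⟨hv.1.ne', hu.1.ne'⟩
    · exact ContinuousAt.rpow continuousAt_const
        (ContinuousAt.div (by fun_prop) (by fun_prop) (by simp)) (Or.inl (div_pos c1 c2).ne')
    · exact ContinuousAt.div (by fun_prop) (by fun_prop) (by simpa using c1.ne')
  have h1 := hc.tendsto.mono_left (nhdsWithin_le_nhds (s := Ioi 0))
  have e1 : sin u / sin v * (sin v / sin u) = 1 := by field_simp
  simp only [zero_mul, sinc_zero, sub_zero, rpow_zero, one_mul, div_one, rpow_one,
    e1] at h1
  refine h1.congr' ?_
  filter_upwards [self_mem_nhdsWithin] with α hα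
  have hα : 0 < α := hα
  rw [stableQ, sinc_of_ne_zero (mul_pos hα hu.1).ne', sinc_of_ne_zero (mul_pos hα hv.1).ne']
  congr 3
  have := hu.1
  have := hv.1
  field_simp

theorem tendsto_integral_integrand_zero {t : ℝ} (ht : 0 < t) :
    Tendsto (fun α => ∫ u, 1 / (1 + stableQ α u.1 u.2 / t) ∂uniformAngle.prod uniformAngle)
      (𝓝[>] 0) (𝓝 (t / (1 + t))) := by
  have h1 : ∫ _u : ℝ × ℝ, 1 / (1 + 1 / t) ∂uniformAngle.prod uniformAngle = t / (1 + t) := by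
    rw [integral_const, probReal_univ, one_smul]
    field_simp
    ring
  rw [← h1]
  have hα1 : ∀ᶠ α in 𝓝[>] (0 : ℝ), α ∈ Ioo (0 : ℝ) 1 := Ioo_mem_nhdsGT one_pos
  refine tendsto_integral_filter_of_dominated_convergence (fun _ => 1) ?_ ?_
    (integrable_const _) ?_
  · filter_upwards [hα1] with α hα
    exact (integrable_integrand hα ht.le).aestronglyMeasurable
  · filter_upwards [hα1] with α hα
    filter_upwards [ae_uniformAngle_prod_mem] with u hu
    have := integrand_mem_Icc (stableQ_pos hα hu.1 hu.2).le ht.le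
    rw [norm_of_nonneg this.1]
    exact this.2
  · filter_upwards [ae_uniformAngle_prod_mem] with u hu
    exact tendsto_const_nhds.div (tendsto_const_nhds.add
      ((tendsto_stableQ_zero hu.1 hu.2).div_const t)) (by positivity)

/-! ### The case α = 1/2 -/

lemma stableQ_half {u v : ℝ} (hu : u ∈ Ioo 0 π) (hv : v ∈ Ioo 0 π) :
    stableQ (1 / 2) u v = cos (u / 2) ^ 2 / cos (v / 2) ^ 2 := by
  have pos : ∀ {w : ℝ}, w ∈ Ioo 0 π → 0 < sin (w / 2) ∧ 0 < cos (w / 2) := fun {w} hw =>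
    ⟨sin_pos_of_pos_of_lt_pi (by linarith [hw.1]) (by linarith [hw.2, pi_pos]),
      cos_pos_of_mem_Ioo ⟨by linarith [hw.1, pi_pos], by linarith [hw.2]⟩⟩
  have dbl : ∀ w : ℝ, sin w = 2 * sin (w / 2) * cos (w / 2) := fun w => by
    rw [← sin_two_mul]; ring_nf
  obtain ⟨su, cu⟩ := pos hu
  obtain ⟨sv, cv⟩ := pos hv
  rw [stableQ, show (1 / 2 : ℝ) / (1 - 1 / 2) = 1 by norm_num,
    show (1 : ℝ) / (1 - 1 / 2) = (2 : ℕ) by norm_num, rpow_one, rpow_natCast,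
    show u - 1 / 2 * u = u / 2 by ring, show v - 1 / 2 * v = v / 2 by ring,
    show 1 / 2 * u = u / 2 by ring, show 1 / 2 * v = v / 2 by ring, dbl u, dbl v]
  field_simp

lemma cos_half_pos {u : ℝ} (hu : u ∈ Ioo 0 π) : 0 < cos (u / 2) :=
  cos_pos_of_mem_Ioo ⟨by linarith [hu.1, pi_pos], by linarith [hu.2]⟩

/-- The primitive comes from the substitution tan(u/2). The tangent blows up at π, so endpoint
limits are used instead of endpoint values. -/
lemma integral_one_div_one_add_mul_cos_sq {k : ℝ} (hk : 0 ≤ k) :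
    ∫ u in (0 : ℝ)..π, 1 / (1 + k * cos (u / 2) ^ 2) = π / √(1 + k) := by
  have hk1 : 0 < 1 + k := by linarith
  have hs : 0 < √(1 + k) := sqrt_pos.2 hk1
  have hsq : √(1 + k) ^ 2 = 1 + k := sq_sqrt hk1.le
  have hd : ∀ u ∈ Ioo 0 π, HasDerivAt (fun u => 2 / √(1 + k) * arctan (tan (u / 2) / √(1 + k)))
      (1 / (1 + k * cos (u / 2) ^ 2)) u := fun u hu => by
    have hc := cos_half_pos hu
    have h1 : HasDerivAt (fun u : ℝ => tan (u / 2)) (1 / cos (u / 2) ^ 2 * (1 / 2)) u :=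
      HasDerivAt.comp u (h₂ := tan) (h := fun u => u / 2) (hasDerivAt_tan hc.ne')
        ((hasDerivAt_id u).div_const 2)
    refine (((h1.div_const (√(1 + k))).arctan).const_mul (2 / √(1 + k))).congr_deriv ?_
    have h2 : tan (u / 2) ^ 2 = (1 - cos (u / 2) ^ 2) / cos (u / 2) ^ 2 := by
      rw [tan_eq_sin_div_cos, div_pow, sin_sq]
    rw [div_pow, hsq, h2]
    have : 0 < 1 + k * cos (u / 2) ^ 2 := by positivity
    have e : 1 + (1 - cos (u / 2) ^ 2) / cos (u / 2) ^ 2 / (1 + k) =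
        (1 + k * cos (u / 2) ^ 2) / (cos (u / 2) ^ 2 * (1 + k)) := by
      field_simp
      ring
    rw [e]
    field_simp
    rw [hsq]
  have hint : IntervalIntegrable (fun u => 1 / (1 + k * cos (u / 2) ^ 2)) volume 0 π := by
    refine Continuous.intervalIntegrable ?_ _ _
    exact Continuous.div (by fun_prop) (by fun_prop) fun u => by positivity
  have h0 : Tendsto (fun u => 2 / √(1 + k) * arctan (tan (u / 2) / √(1 + k))) (𝓝[>] 0) (𝓝 0) := by
    have hc : ContinuousAt (fun u => 2 / √(1 + k) * arctan (tan (u / 2) / √(1 + k))) 0 := by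
      have : ContinuousAt (fun u : ℝ => tan (u / 2)) 0 :=
        ContinuousAt.comp (g := tan) (continuousAt_tan.2 (by simp)) (by fun_prop)
      exact ((continuous_arctan.continuousAt.comp (this.div_const _))).const_mul _
    have := hc.tendsto.mono_left (nhdsWithin_le_nhds (s := Ioi 0))
    simpa using this
  have hπ : Tendsto (fun u => 2 / √(1 + k) * arctan (tan (u / 2) / √(1 + k))) (𝓝[<] π)
      (𝓝 (2 / √(1 + k) * (π / 2))) := by
    have h1 : Tendsto (fun u : ℝ => u / 2) (𝓝[<] π) (𝓝[<] (π / 2)) := by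
      refine tendsto_nhdsWithin_iff.2 ⟨?_, ?_⟩
      · exact (Continuous.tendsto (by fun_prop) π).mono_left nhdsWithin_le_nhds
      · filter_upwards [self_mem_nhdsWithin] with u hu
        have : u < π := hu
        simp only [mem_Iio]; linarith
    have h2 := (tendsto_tan_pi_div_two.comp h1).atTop_div_const hs
    exact ((tendsto_arctan_atTop.mono_right nhdsWithin_le_nhds).comp h2).const_mul _
  rw [intervalIntegral.integral_eq_sub_of_hasDerivAt_of_tendsto pi_pos hd hint h0 hπ]
  field_simp
  ring

/-- With r = √t/√(1+t), a primitive is 2 arcsin(r sin(u/2)); its value at π is 2 arcsin r = 2 arctan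
√t. -/
lemma integral_cos_div_sqrt {t : ℝ} (ht : 0 < t) :
    ∫ u in (0 : ℝ)..π, √t * cos (u / 2) / √(1 + t * cos (u / 2) ^ 2) = 2 * arctan √t := by
  have h1t : 0 < 1 + t := by linarith
  set r := √t / √(1 + t) with hr
  have hr0 : 0 < r := by positivity
  have hr2 : r ^ 2 = t / (1 + t) := by rw [hr, div_pow, sq_sqrt ht.le, sq_sqrt h1t.le]
  have hr1 : r ^ 2 < 1 := by rw [hr2, div_lt_one h1t]; linarith
  have hd : ∀ u ∈ uIcc 0 π, HasDerivAt (fun u => 2 * arcsin (r * sin (u / 2)))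
      (√t * cos (u / 2) / √(1 + t * cos (u / 2) ^ 2)) u := fun u _ => by
    have h1 : HasDerivAt (fun u : ℝ => r * sin (u / 2)) (r * (cos (u / 2) * (1 / 2))) u :=
      (((hasDerivAt_sin _).comp u ((hasDerivAt_id u).div_const 2))).const_mul r
    have hlt : (r * sin (u / 2)) ^ 2 < 1 := by
      rw [mul_pow]
      nlinarith [sin_sq_le_one (u / 2), sq_nonneg (sin (u / 2)), sq_nonneg r]
    have hne := abs_lt.1 ((sq_lt_one_iff_abs_lt_one _).1 hlt)
    refine (((hasDerivAt_arcsin hne.1.ne' hne.2.ne).comp u h1).const_mul 2).congr_deriv ?_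
    have e : 1 - (r * sin (u / 2)) ^ 2 = (1 + t * cos (u / 2) ^ 2) / (1 + t) := by
      rw [mul_pow, hr2, sin_sq]
      field_simp
      ring
    have : 0 < √(1 + t * cos (u / 2) ^ 2) := sqrt_pos.2 (by positivity)
    have : 0 < √(1 + t) := sqrt_pos.2 h1t
    rw [e, sqrt_div (by positivity), hr]
    field_simp
  rw [intervalIntegral.integral_eq_sub_of_hasDerivAt hd]
  · rw [arctan_eq_arcsin, sq_sqrt ht.le]
    simp [hr]
  · refine Continuous.intervalIntegrable ?_ _ _
    exact Continuous.div (by fun_prop) (by fun_prop) fun u => (sqrt_pos.2 (by positivity)).ne'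

theorem integral_integrand_half {t : ℝ} (ht : 0 < t) :
    ∫ u, 1 / (1 + stableQ (1 / 2) u.1 u.2 / t) ∂uniformAngle.prod uniformAngle =
      2 / π * arctan √t := by
  have hh : (1 / 2 : ℝ) ∈ Ioo (0 : ℝ) 1 := by constructor <;> norm_num
  rw [integral_prod_symm _ (integrable_integrand hh ht.le)]
  have h1 : ∀ᵐ v ∂uniformAngle, ∫ u, 1 / (1 + stableQ (1 / 2) u v / t) ∂uniformAngle =
      √t * cos (v / 2) / √(1 + t * cos (v / 2) ^ 2) := by
    filter_upwards [ae_uniformAngle_mem] with v hv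
    have cv := cos_half_pos hv
    have h2 : ∫ u, 1 / (1 + stableQ (1 / 2) u v / t) ∂uniformAngle =
        ∫ u, 1 / (1 + 1 / (t * cos (v / 2) ^ 2) * cos (u / 2) ^ 2) ∂uniformAngle := by
      refine integral_congr_ae ?_
      filter_upwards [ae_uniformAngle_mem] with u hu
      rw [stableQ_half hu hv]
      congr 2
      field_simp
    rw [h2, integral_uniformAngle, ← integral_Ioc_eq_integral_Ioo,
      ← intervalIntegral.integral_of_le pi_pos.le,
      integral_one_div_one_add_mul_cos_sq (by positivity)]
    have e : 1 + 1 / (t * cos (v / 2) ^ 2) =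
        (1 + t * cos (v / 2) ^ 2) / (√t * cos (v / 2)) ^ 2 := by
      rw [mul_pow, sq_sqrt ht.le]; field_simp; ring
    have : 0 < √t := sqrt_pos.2 ht
    have : 0 < √(1 + t * cos (v / 2) ^ 2) := sqrt_pos.2 (by positivity)
    rw [e, sqrt_div (by positivity), sqrt_sq (by positivity)]
    field_simp
  rw [integral_congr_ae h1, integral_uniformAngle, ← integral_Ioc_eq_integral_Ioo,
    ← intervalIntegral.integral_of_le pi_pos.le, integral_cos_div_sqrt ht]
  field_simp

/-! ### Assembly of the theorem -/

theorem lemma2 :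
    -- the distributions `S(α,1,1)`, `0 < α < 1`, exist
    (∀ α ∈ Ioo (0 : ℝ) 1, ∃ μ : Measure ℝ, IsMaxSkewedStable α μ) ∧
    -- for each `α`, any i.i.d. pair `S₁ α, S₂ α` with distribution `S(α,1,1)`, on any space
    ∀ (Ω : ℝ → Type*) [∀ α, MeasurableSpace (Ω α)] (P : ∀ α, Measure (Ω α))
      (S₁ S₂ : ∀ α, Ω α → ℝ),
      (∀ α ∈ Ioo (0 : ℝ) 1, IsIIDStablePair α (P α) (S₁ α) (S₂ α)) →
      ∀ F : ℝ → ℝ → ℝ, (∀ α t : ℝ, F α t = ratioCDF α (P α) (S₁ α) (S₂ α) t) →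
      -- the double integral formula (for `t = 0` the integrand is read as its limit `0`)
      (∀ α ∈ Ioo (0 : ℝ) 1,
        F α 0 = 0 ∧
        ∀ t : ℝ, 0 < t →
          IntegrableOn (fun u : ℝ × ℝ => 1 / (1 + stableQ α u.1 u.2 / t))
            (Icc 0 π ×ˢ Icc 0 π) ∧
          F α t = 1 / π ^ 2 *
            ∫ u in Icc (0 : ℝ) π ×ˢ Icc (0 : ℝ) π, 1 / (1 + stableQ α u.1 u.2 / t)) ∧
      -- the limit `α → 0+`
      (∀ t : ℝ, 0 ≤ t → Tendsto (fun α => F α t) (𝓝[>] 0) (𝓝 (t / (1 + t)))) ∧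
      -- the case `α = 1/2`
      (∀ t : ℝ, 0 ≤ t → F (1 / 2) t = 2 / π * arctan (√t)) ∧
      -- monotonicity in `α` and the bounds
      (∀ t ∈ Icc (0 : ℝ) 1, ∀ α₁ α₂ : ℝ, 0 < α₁ → α₁ ≤ α₂ → α₂ ≤ 1 / 2 →
        t / (1 + t) ≤ F α₁ t ∧ F α₁ t ≤ F α₂ t ∧ F α₂ t ≤ 2 / π * arctan (√t)) := by
  refine ⟨fun α hα => ⟨kanterLaw α, isMaxSkewedStable_kanterLaw hα⟩, ?_⟩
  intro Ω _ P S₁ S₂ h F hF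
  have hF0 : ∀ α ∈ Ioo (0 : ℝ) 1, F α 0 = 0 := fun α hα => by
    rw [hF, ratioCDF_zero hα (h α hα)]
  have hFt : ∀ α ∈ Ioo (0 : ℝ) 1, ∀ t : ℝ, 0 < t → F α t =
      ∫ u, 1 / (1 + stableQ α u.1 u.2 / t) ∂uniformAngle.prod uniformAngle := fun α hα t ht => by
    rw [hF, ratioCDF_eq_integral hα ht (h α hα)]
  have hhalf : (1 / 2 : ℝ) ∈ Ioo (0 : ℝ) 1 := by constructor <;> norm_num
  have hmem : ∀ᶠ α in 𝓝[>] (0 : ℝ), α ∈ Ioo (0 : ℝ) 1 := Ioo_mem_nhdsGT one_pos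
  refine ⟨fun α hα => ⟨hF0 α hα, fun t ht => ⟨integrableOn_integrand hα ht.le, ?_⟩⟩, ?_, ?_, ?_⟩
  · rw [hFt α hα t ht, integral_uniformAngle_prod]
  · intro t ht
    rcases ht.eq_or_lt with rfl | ht
    · rw [zero_div]
      exact tendsto_const_nhds.congr' (hmem.mono fun α hα => (hF0 α hα).symm)
    · exact (tendsto_integral_integrand_zero ht).congr'
        (hmem.mono fun α hα => (hFt α hα t ht).symm)
  · intro t ht
    rcases ht.eq_or_lt with rfl | ht
    · rw [hF0 _ hhalf, sqrt_zero, arctan_zero, mul_zero]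
    · rw [hFt _ hhalf t ht, integral_integrand_half ht]
  · intro t ht α₁ α₂ h₁ h₁₂ h₂
    have hα₁ : α₁ ∈ Ioo (0 : ℝ) 1 := ⟨h₁, by linarith⟩
    have hα₂ : α₂ ∈ Ioo (0 : ℝ) 1 := ⟨by linarith, by linarith⟩
    rcases ht.1.eq_or_lt with rfl | ht0
    · simp [hF0 _ hα₁, hF0 _ hα₂]
    -- The arctangent is the value at α = 1/2, so the upper bound is one more instance of
    -- monotonicity in α.
    · rw [hFt _ hα₁ t ht0, hFt _ hα₂ t ht0, ← integral_integrand_half ht0]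
      exact ⟨le_integral_integrand hα₁ ht0 ht.2, integral_integrand_mono hα₁ hα₂ h₁₂ ht0 ht.2,
        integral_integrand_mono hα₂ hhalf h₂ ht0 ht.2⟩
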